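/- Let $d\ge 1$, let $f(z)=\prod_{j=1}^d (z-\zeta_j)$ with distinct $\zeta_j\in\mathbb C$, $|\zeta_j|<1$ (the class $\mathcal P_d(1)$), and let $r>1$. Let $\mathcal C_f=\{c\in\mathbb C : f'(c)=0\}$. Let $\mathcal S=\{(z,w)\in\mathbb C^2 : w=f(z)\}$ be the branched cover associated with $f$, with $\hat f:\mathbb C\to\mathcal S$, $\hat f(z)=(z,f(z))$, and $\pi:\mathcal S\to\mathbb C$, $\pi(z,w)=w$, so that $f=\pi\circ\hat f$. Give $\mathcal S$ the length metric lifted by $\pi$: $\operatorname{dist}(u,v)$ is the infimum, over all continuous paths $\gamma$ in $\mathcal S$ from $u$ to $v$, of the Euclidean length of $\pi\circ\gamma$. For $c\in\mathcal C_f$ the Voronoi domain of $\hat f(c)$ is $$\operatorname{Vor}(\hat f(c))=\{u\in\mathcal S : \operatorname{dist}(u,\hat f(c))\le \operatorname{dist}(u,\hat f(c'))\ \text{for all } c'\in\mathcal C_f\}.$$ A critical point $c$ *influences* $z\in\mathbb C$ if, for some point $\hat 0\in\mathcal S$ with $\pi(\hat 0)=0$, there is a path in $\mathcal S$ from $\hat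 0$ to $\hat f(z)$ that lifts the line segment from $0$ to $f(z)$ and meets $\operatorname{Vor}(\hat f(c))$. For $t\in[0,1]$ let $\mathcal I_t$ be the set of the $c\in\mathcal C_f$ that influence $re^{2\pi i t}$, and put $\theta(t,c)=\operatorname{Arg}\dfrac{f(re^{2\pi i t})}{f(c)}\in(-\pi,\pi]$. **Proposition 8.2.** The function $t\mapsto \sum_{c\in\mathcal I_t,\ |\theta(t,c)|<\pi/2}\log\dfrac{4+\tan|\theta(t,c)|}{\sec|\theta(t,c)|-1}$ is integrable on $[0,1]$, and $$\int_0^1\ \sum_{\substack{c\in\mathcal I_t\\ |\theta(t,c)|<\pi/2}}\log\frac{4+\tan|\theta(t,c)|}{\sec|\theta(t,c)|-1}\,dt\ \le\ 3\cdot\frac{r+1}{r}.$$ (The summand is infinite where $\theta(t,c)=0$, which happens only for finitely many $t$.) -/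

import Mathlib

open Polynomial
open scoped ENNReal

/-- The class `P_d(1)`: monic complex polynomials of degree `d` with `d` distinct roots,
all of them in the open unit disk. -/
def unitDiskPolys (d : ℕ) : Set ℂ[X] :=
  {f | ∃ ζ : Fin d → ℂ, Function.Injective ζ ∧ (∀ j, ‖ζ j‖ < 1) ∧ f = ∏ j, (X - C (ζ j))}

/-- The set `C_f` of critical points of `f`. -/
def criticalPoints (f : ℂ[X]) : Set ℂ :=
  {c | f.derivative.eval c = 0}

/-- The branched cover `S` attached to `f` (the Riemann surface of `f⁻¹`): a point of it is a
pair `(z, w)` with `w = f z`. -/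
def BranchedCover (f : ℂ[X]) : Type :=
  {p : ℂ × ℂ // p.2 = f.eval p.1}

namespace BranchedCover

variable {f : ℂ[X]}

/-- The topology of `S` is the subspace topology of the graph, so that `hat f` is a
homeomorphism from `ℂ` onto `S`. -/
instance : TopologicalSpace (BranchedCover f) :=
  inferInstanceAs (TopologicalSpace {p : ℂ × ℂ // p.2 = f.eval p.1})

/-- The bijection `hat f` from the source plane onto `S`. -/
def hat (f : ℂ[X]) (z : ℂ) : BranchedCover f :=
  ⟨(z, f.eval z), rfl⟩

/-- The projection `π` from `S` to the target plane; `f = π ∘ hat f`. -/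
def proj (u : BranchedCover f) : ℂ :=
  u.1.2

/-- The length of a path in `S`. As the metric of `S` is lifted by `π`, it is the Euclidean
length (total variation) of the projected path in the target plane. -/
noncomputable def pathLength {u v : BranchedCover f} (γ : Path u v) : ℝ≥0∞ :=
  eVariationOn (fun s => proj (γ s)) Set.univ

/-- The distance on `S`: the length metric for which `π` is a local isometry away from the
branch points, that is, the infimum of the lengths of the paths from `u` to `v`. -/
noncomputable def surfaceDist (u v : BranchedCover f) : ℝ≥0∞ :=
  ⨅ γ : Path u v, pathLength γ

/-- The Voronoi domain of `v` relative to the set `hat f (C_f)` of critical values in `S`. -/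
def voronoi (v : BranchedCover f) : Set (BranchedCover f) :=
  {u | ∀ c ∈ criticalPoints f, surfaceDist u v ≤ surfaceDist u (hat f c)}

/-- The lifted segment `[u₁, u₂]` in `S`: the points on a path in `S` from `u₁` to `u₂` that is a
lift of the line segment from `π u₁` to `π u₂`. It is empty if there is no such path. -/
def liftSeg (u₁ u₂ : BranchedCover f) : Set (BranchedCover f) :=
  {u | ∃ γ : Path u₁ u₂,
    (∀ s : unitInterval, proj (γ s) = AffineMap.lineMap (proj u₁) (proj u₂) (s : ℝ)) ∧
    u ∈ Set.range γ}

end BranchedCover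

/-- The critical point `c` influences the orbit of `z`: the lifted segment from a point `0̂` of `S`
over `0` to `hat f z` meets the Voronoi domain of `hat f c`. -/
def Influences (f : ℂ[X]) (c z : ℂ) : Prop :=
  ∃ o : BranchedCover f, o.proj = 0 ∧
    (BranchedCover.liftSeg o (BranchedCover.hat f z) ∩
      BranchedCover.voronoi (BranchedCover.hat f c)).Nonempty

/-- The starting point `r e^{2πit}` on the circle of radius `r`. -/
noncomputable def startPoint (r t : ℝ) : ℂ :=
  r * Complex.exp (2 * Real.pi * t * Complex.I)

/-- The set `I_t` of the critical points that influence the starting point `r e^{2πit}`. -/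
def influencing (f : ℂ[X]) (r t : ℝ) : Set ℂ :=
  {c | c ∈ criticalPoints f ∧ Influences f c (startPoint r t)}

/-- The angle `θ(t, c) = Arg (f(r e^{2πit}) / f(c))`, in `(-π, π]`. -/
noncomputable def influenceAngle (f : ℂ[X]) (r t : ℝ) (c : ℂ) : ℝ :=
  Complex.arg (f.eval (startPoint r t) / f.eval c)

/-- The sum over the influencing critical points `c` with `|θ(t, c)| < π/2` of
`log ((4 + tan |θ|) / (sec |θ| - 1))`. -/
noncomputable def labelSum (f : ℂ[X]) (r t : ℝ) : ℝ :=
  ∑ᶠ c ∈ {c | c ∈ influencing f r t ∧ |influenceAngle f r t c| < Real.pi / 2},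
    Real.log ((4 + Real.tan |influenceAngle f r t c|) /
      ((Real.cos |influenceAngle f r t c|)⁻¹ - 1))

open Set Filter Topology

/-- A connected set covered by `N` disks of radius `δ` has diameter at most `2Nδ`. -/
theorem dist_le_of_isPreconnected_of_cover {K : Set ℂ} (hK : IsPreconnected K) (T : Multiset ℂ)
    {δ : ℝ} (hδ : 0 ≤ δ) (hcov : ∀ z ∈ K, ∃ a ∈ T, ‖z - a‖ ≤ δ) {z z' : ℂ} (hz : z ∈ K)
    (hz' : z' ∈ K) : ‖z - z'‖ ≤ 2 * (T.card * δ) := by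
  classical
  set h : ℂ → ℝ := fun y => ‖y - z'‖
  have hc : Continuous h := by fun_prop
  have hI : Icc 0 ‖z - z'‖ ⊆ ⋃ a ∈ T.toFinset, Metric.closedBall (h a) δ := by
    have h1 : Icc (h z') (h z) ⊆ h '' K :=
      (hK.image h hc.continuousOn).Icc_subset (mem_image_of_mem h hz') (mem_image_of_mem h hz)
    intro x hx
    obtain ⟨y, hy, rfl⟩ := h1 (by simpa [h] using hx)
    obtain ⟨a, ha, hya⟩ := hcov y hy
    simp only [mem_iUnion]
    refine ⟨a, by simpa using ha, ?_⟩
    rw [Metric.mem_closedBall, Real.dist_eq]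
    refine (abs_norm_sub_norm_le _ _).trans ?_
    simpa using hya
  have h2 : ENNReal.ofReal ‖z - z'‖ ≤ ∑ a ∈ T.toFinset, ENNReal.ofReal (2 * δ) := by
    calc ENNReal.ofReal ‖z - z'‖ = MeasureTheory.volume (Icc 0 ‖z - z'‖) := by simp
      _ ≤ MeasureTheory.volume (⋃ a ∈ T.toFinset, Metric.closedBall (h a) δ) :=
          MeasureTheory.measure_mono hI
      _ ≤ ∑ a ∈ T.toFinset, MeasureTheory.volume (Metric.closedBall (h a) δ) :=
          MeasureTheory.measure_biUnion_finset_le _ _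
      _ = _ := by simp [Real.volume_closedBall]
  rw [Finset.sum_const, nsmul_eq_mul, ← ENNReal.ofReal_natCast,
    ← ENNReal.ofReal_mul (by positivity), ENNReal.ofReal_le_ofReal_iff (by positivity)] at h2
  have h3 : (T.toFinset.card : ℝ) ≤ T.card := by exact_mod_cast T.toFinset_card_le
  nlinarith

/-- For a monic polynomial the value is the product of the distances to the roots. -/
theorem norm_eval_sub_eq_prod {f : ℂ[X]} (hf : f.Monic) (hd : 0 < f.natDegree) (w z : ℂ) :
    ‖f.eval z - w‖ = ((f - C w).roots.map fun a => ‖z - a‖).prod := by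
  have hm : (f - C w).Monic := by
    refine hf.sub_of_left (degree_C_le.trans_lt ?_)
    exact natDegree_pos_iff_degree_pos.mp hd
  have h1 : f.eval z - w = ((f - C w).roots.map fun a => z - a).prod := by
    have := (IsAlgClosed.splits (f - C w)).eq_prod_roots_of_monic hm
    calc f.eval z - w = (f - C w).eval z := by simp
      _ = _ := by
        conv_lhs => rw [this]
        rw [eval_multiset_prod, Multiset.map_map]
        simp
  rw [h1]
  induction (f - C w).roots using Multiset.induction_on with
  | empty => simp
  | cons a s ih => simp [ih]

theorem card_roots_sub_C_eq_natDegree {f : ℂ[X]} (w : ℂ) : (f - C w).roots.card = f.natDegree := by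
  rw [← (IsAlgClosed.splits (f - C w)).natDegree_eq_card_roots, natDegree_sub_C]

theorem exists_root_norm_sub_le {f : ℂ[X]} (hf : f.Monic) (hd : 0 < f.natDegree) {w z : ℂ}
    {η : ℝ} (h : ‖f.eval z - w‖ ≤ η) :
    ∃ a ∈ (f - C w).roots, ‖z - a‖ ≤ η ^ (1 / (f.natDegree : ℝ)) := by
  have hη : 0 ≤ η := (norm_nonneg _).trans h
  by_contra! hcon
  rw [norm_eval_sub_eq_prod hf hd] at h
  set δ := η ^ (1 / (f.natDegree : ℝ)) with hδ
  have hδ0 : 0 ≤ δ := Real.rpow_nonneg hη _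
  have hpow : δ ^ f.natDegree = η := by
    rw [hδ, ← Real.rpow_natCast, ← Real.rpow_mul hη]
    field_simp
    simp
  have key : ∀ s : Multiset ℂ, (∀ a ∈ s, δ < ‖z - a‖) → 0 < s.card →
      δ ^ s.card < (s.map fun a => ‖z - a‖).prod := by
    intro s
    induction s using Multiset.induction_on with
    | empty => simp
    | cons a s ih =>
      intro hs _
      have ha := hs a (by simp)
      rcases Nat.eq_zero_or_pos s.card with h0 | h0
      · rw [Multiset.card_eq_zero] at h0
        simpa [h0] using ha
      · have := ih (fun b hb => hs b (by simp [hb])) h0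
        rw [Multiset.card_cons, pow_succ', Multiset.map_cons, Multiset.prod_cons]
        exact mul_lt_mul'' ha this hδ0 (by positivity)
  have := key _ hcon (by rw [card_roots_sub_C_eq_natDegree]; exact hd)
  rw [card_roots_sub_C_eq_natDegree, hpow] at this
  linarith

/-- A modulus of continuity for the inverse of a polynomial of degree `d` along connected sets. -/
noncomputable def liftModulus (d : ℕ) (η : ℝ) : ℝ := 2 * (d * η ^ (1 / (d : ℝ)))

theorem continuous_liftModulus (d : ℕ) : Continuous (liftModulus d) := by
  unfold liftModulus
  have : Continuous fun η : ℝ => η ^ (1 / (d : ℝ)) :=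
    Real.continuous_rpow_const (by positivity)
  fun_prop

theorem liftModulus_zero {d : ℕ} (hd : 0 < d) : liftModulus d 0 = 0 := by
  unfold liftModulus
  rw [Real.zero_rpow (by positivity)]
  simp

/-- If `f` varies little on a connected set then the set is small. -/
theorem norm_sub_le_liftModulus {f : ℂ[X]} (hf : f.Monic) (hd : 0 < f.natDegree) {K : Set ℂ}
    (hK : IsPreconnected K) {w : ℂ} {η : ℝ} (h : ∀ z ∈ K, ‖f.eval z - w‖ ≤ η) {z z' : ℂ}
    (hz : z ∈ K) (hz' : z' ∈ K) : ‖z - z'‖ ≤ liftModulus f.natDegree η := by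
  have hη : 0 ≤ η := (norm_nonneg _).trans (h z hz)
  have := dist_le_of_isPreconnected_of_cover hK (f - C w).roots (Real.rpow_nonneg hη _)
    (fun z hz => exists_root_norm_sub_le hf hd (h z hz)) hz hz'
  rwa [card_roots_sub_C_eq_natDegree] at this

/-- Monic polynomials of positive degree are proper. -/
theorem exists_norm_le_of_norm_eval_le {f : ℂ[X]} (hf : f.Monic) (hd : 0 < f.natDegree) (M : ℝ) :
    ∃ R, 0 ≤ R ∧ ∀ z, ‖f.eval z‖ ≤ M → ‖z‖ ≤ R := by
  classical
  set η := M ^ (1 / (f.natDegree : ℝ))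
  refine ⟨(f.roots.map fun a => ‖a‖).sum + |η|, ?_, fun z hz => ?_⟩
  · refine add_nonneg (Multiset.sum_nonneg fun x hx => ?_) (abs_nonneg _)
    obtain ⟨y, -, rfl⟩ := Multiset.mem_map.1 hx
    exact norm_nonneg _
  · obtain ⟨a, ha, hza⟩ := exists_root_norm_sub_le (w := 0) hf hd (by simpa using hz)
    have h1 : ‖a‖ ≤ (f.roots.map fun a => ‖a‖).sum := by
      refine Multiset.single_le_sum (fun x hx => ?_) _ (Multiset.mem_map_of_mem _ ?_)
      · obtain ⟨y, -, rfl⟩ := Multiset.mem_map.1 hx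
        exact norm_nonneg _
      · simpa using ha
    calc ‖z‖ ≤ ‖z - a‖ + ‖a‖ := by simpa using norm_add_le (z - a) a
      _ ≤ |η| + ‖a‖ := by gcongr; exact hza.trans (le_abs_self _)
      _ ≤ _ := by linarith

open unitInterval in
/-- Paths whose image under `f` is `L`-Lipschitz form a compact family. -/
theorem isCompact_lipschitz_lifts {f : ℂ[X]} (hf : f.Monic) (hd : 0 < f.natDegree) (L M : ℝ) :
    IsCompact {γ : BoundedContinuousFunction I ℂ |
      (∀ s s' : I, ‖f.eval (γ s) - f.eval (γ s')‖ ≤ L * |(s : ℝ) - s'|) ∧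
      ‖f.eval (γ 0)‖ ≤ M} := by
  obtain ⟨R, -, hR⟩ := exists_norm_le_of_norm_eval_le hf hd (M + |L|)
  refine BoundedContinuousFunction.arzela_ascoli₂ (Metric.closedBall (0 : ℂ) R)
    (isCompact_closedBall _ _) _ ?_ ?_ ?_
  · have hev : ∀ s : I, Continuous fun γ : BoundedContinuousFunction I ℂ => f.eval (γ s) :=
      fun s => f.continuous.comp (continuous_eval_const s)
    have : {γ : BoundedContinuousFunction I ℂ |
      (∀ s s' : I, ‖f.eval (γ s) - f.eval (γ s')‖ ≤ L * |(s : ℝ) - s'|) ∧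
      ‖f.eval (γ 0)‖ ≤ M} = (⋂ s : I, ⋂ s' : I,
        {γ | ‖f.eval (γ s) - f.eval (γ s')‖ ≤ L * |(s : ℝ) - s'|}) ∩
        {γ | ‖f.eval (γ 0)‖ ≤ M} := by
      ext; simp only [mem_ofPred_eq, mem_inter_iff, mem_iInter]
    rw [this]
    refine (isClosed_iInter fun s => isClosed_iInter fun s' => ?_).inter ?_
    · exact isClosed_le ((hev s).sub (hev s')).norm continuous_const
    · exact isClosed_le (hev 0).norm continuous_const
  · rintro γ s ⟨h1, h2⟩
    rw [mem_closedBall_zero_iff]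
    apply hR
    have h3 := h1 s 0
    have h4 : L * |(s : ℝ) - (0 : I)| ≤ |L| := by
      have : |(s : ℝ) - (0 : I)| ≤ 1 := by
        rw [abs_le]
        have := s.2.1
        have := s.2.2
        constructor <;> simp <;> linarith
      calc L * |(s : ℝ) - (0 : I)| ≤ |L| * |(s : ℝ) - (0 : I)| := by
            gcongr; exact le_abs_self _
        _ ≤ |L| * 1 := by gcongr
        _ = _ := by simp
    calc ‖f.eval (γ s)‖ ≤ ‖f.eval (γ 0)‖ + ‖f.eval (γ s) - f.eval (γ 0)‖ := norm_le_insert' _ _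
      _ ≤ _ := by linarith
  · refine Metric.equicontinuous_of_continuity_modulus
      (fun x => liftModulus f.natDegree (|L| * x)) ?_ _ ?_
    · have h1 : Continuous fun x => liftModulus f.natDegree (|L| * x) :=
        (continuous_liftModulus _).comp (by fun_prop)
      have := h1.tendsto 0
      simpa [liftModulus_zero hd] using this
    · rintro s s' ⟨γ, h1, -⟩
      rw [dist_eq_norm]
      refine norm_sub_le_liftModulus hf hd (K := γ '' uIcc s s') (w := f.eval (γ s)) ?_ ?_
        (mem_image_of_mem _ left_mem_uIcc) (mem_image_of_mem _ right_mem_uIcc)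
      · exact isPreconnected_uIcc.image _ γ.continuous.continuousOn
      · rintro _ ⟨y, hy, rfl⟩
        refine (h1 y s).trans ?_
        have h5 : |(y : ℝ) - s| ≤ |(s : ℝ) - s'| := by
          rw [abs_sub_comm (s : ℝ)]
          apply abs_sub_left_of_mem_uIcc
          rw [mem_uIcc] at hy ⊢
          exact_mod_cast hy
        rw [Subtype.dist_eq, Real.dist_eq]
        calc L * |(y : ℝ) - s| ≤ |L| * |(y : ℝ) - s| := by gcongr; exact le_abs_self _
          _ ≤ _ := by gcongr

open BranchedCover

/-- The inverse function theorem for a polynomial at a noncritical point. -/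
theorem exists_openPartialHomeomorph_eval {f : ℂ[X]} {z : ℂ} (hz : f.derivative.eval z ≠ 0) :
    ∃ e : OpenPartialHomeomorph ℂ ℂ, z ∈ e.source ∧ ∀ y, e y = f.eval y := by
  have h := (f.hasStrictDerivAt z).hasStrictFDerivAt_equiv hz
  exact ⟨h.toOpenPartialHomeomorph _, h.mem_toOpenPartialHomeomorph_source, fun y => rfl⟩

theorem isLocalHomeomorph_eval_regular (f : ℂ[X]) :
    IsLocalHomeomorph fun z : {z : ℂ // f.derivative.eval z ≠ 0} => f.eval (z : ℂ) := by
  have hopen : IsOpen {z : ℂ | f.derivative.eval z ≠ 0} :=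
    isOpen_ne_fun f.derivative.continuous continuous_const
  have h1 : IsLocalHomeomorphOn (fun z => f.eval z) {z : ℂ | f.derivative.eval z ≠ 0} := by
    intro z hz
    obtain ⟨e, he, hez⟩ := exists_openPartialHomeomorph_eval hz
    exact ⟨e, he, funext fun y => (hez y).symm⟩
  have h2 : IsLocalHomeomorph (Subtype.val : {z : ℂ // f.derivative.eval z ≠ 0} → ℂ) :=
    hopen.isOpenEmbedding_subtypeVal.isLocalHomeomorph
  rw [isLocalHomeomorph_iff_isLocalHomeomorphOn_univ] at h2 ⊢
  exact h1.comp h2 fun z _ => z.2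

theorem isSeparatedMap_eval_regular (f : ℂ[X]) :
    IsSeparatedMap fun z : {z : ℂ // f.derivative.eval z ≠ 0} => f.eval (z : ℂ) :=
  T2Space.isSeparatedMap _

/-- Uniqueness of lifts: two lifts agree if one of them avoids the critical points. -/
theorem eqOn_of_eval_eqOn {f : ℂ[X]} {A : Type*} [TopologicalSpace A] {s : Set A}
    (hs : IsPreconnected s) {g g' : A → ℂ} (hg : ContinuousOn g s) (hg' : ContinuousOn g' s)
    (he : ∀ a ∈ s, f.eval (g a) = f.eval (g' a)) (hr : ∀ a ∈ s, f.derivative.eval (g a) ≠ 0)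
    {a : A} (ha : a ∈ s) (h : g a = g' a) : EqOn g g' s := by
  have := isPreconnected_iff_preconnectedSpace.mp hs
  rw [continuousOn_iff_continuous_domRestrict] at hg hg'
  have hcl : IsClopen {x : s | g x = g' x} := by
    refine ⟨isClosed_eq hg hg', isOpen_iff_mem_nhds.mpr fun x hx => ?_⟩
    obtain ⟨e, hes, hee⟩ := exists_openPartialHomeomorph_eval (hr x x.2)
    have hx' : g x = g' x := hx
    have h1 := hg.continuousAt.eventually_mem (x := x) (e.open_source.mem_nhds hes)
    have h2 := hg'.continuousAt.eventually_mem (x := x) (e.open_source.mem_nhds (by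
      change g' x ∈ _
      rwa [← hx']))
    filter_upwards [h1, h2] with y hy hy'
    refine e.injOn hy hy' ?_
    rw [hee, hee]
    exact he y y.2
  intro x hx
  have := hcl.eq_univ ⟨⟨a, ha⟩, h⟩
  exact this.symm.subset (mem_univ (⟨x, hx⟩ : s))

/-- A segment lifts as long as the partial lifts do not run into critical points. -/
theorem exists_segment_lift {f : ℂ[X]} (hf : f.Monic) (hd : 0 < f.natDegree) {z₀ w : ℂ}
    (H : ∀ T ∈ Icc (0 : ℝ) 1, ∀ γ : ℝ → ℂ, Continuous γ → γ 0 = z₀ →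
      (∀ s ∈ Icc (0 : ℝ) 1, f.eval (γ s) = f.eval z₀ + (min s T : ℝ) * (w - f.eval z₀)) →
      f.derivative.eval (γ T) ≠ 0) :
    ∃ γ : ℝ → ℂ, Continuous γ ∧ γ 0 = z₀ ∧
      ∀ s ∈ Icc (0 : ℝ) 1, f.eval (γ s) = f.eval z₀ + s * (w - f.eval z₀) := by
  set p := f.eval z₀ with hp
  set S : Set ℝ := {T | ∃ γ : ℝ → ℂ, Continuous γ ∧ γ 0 = z₀ ∧
    ∀ s ∈ Icc (0 : ℝ) 1, f.eval (γ s) = p + (min s T : ℝ) * (w - p)} with hS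
  have hcl : IsClosed (S ∩ Icc 0 1) := by
    have hK := (isCompact_Icc (a := (0 : ℝ)) (b := 1)).prod
      (isCompact_lipschitz_lifts hf hd ‖w - p‖ ‖p‖)
    have hC : IsClosed {x : ℝ × BoundedContinuousFunction unitInterval ℂ | x.2 0 = z₀ ∧
        ∀ s : unitInterval, f.eval (x.2 s) = p + (min (s : ℝ) x.1 : ℝ) * (w - p)} := by
      have hev : ∀ s : unitInterval,
          Continuous fun x : ℝ × BoundedContinuousFunction unitInterval ℂ => x.2 s :=
        fun s => (continuous_eval_const s).comp continuous_snd
      have : {x : ℝ × BoundedContinuousFunction unitInterval ℂ | x.2 0 = z₀ ∧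
          ∀ s : unitInterval, f.eval (x.2 s) = p + (min (s : ℝ) x.1 : ℝ) * (w - p)} =
          {x | x.2 0 = z₀} ∩ ⋂ s : unitInterval,
            {x | f.eval (x.2 s) = p + (min (s : ℝ) x.1 : ℝ) * (w - p)} := by
        ext
        simp only [mem_ofPred_eq, mem_inter_iff, mem_iInter]
      rw [this]
      refine (isClosed_eq (hev 0) continuous_const).inter
        (isClosed_iInter fun s => isClosed_eq (f.continuous.comp (hev s)) ?_)
      fun_prop
    have him : S ∩ Icc 0 1 = Prod.fst '' ((Icc (0 : ℝ) 1 ×ˢ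
        {γ : BoundedContinuousFunction unitInterval ℂ |
          (∀ s s' : unitInterval, ‖f.eval (γ s) - f.eval (γ s')‖ ≤ ‖w - p‖ * |(s : ℝ) - s'|) ∧
          ‖f.eval (γ 0)‖ ≤ ‖p‖}) ∩
        {x : ℝ × BoundedContinuousFunction unitInterval ℂ | x.2 0 = z₀ ∧
          ∀ s : unitInterval, f.eval (x.2 s) = p + (min (s : ℝ) x.1 : ℝ) * (w - p)}) := by
      refine Subset.antisymm ?_ ?_
      · rintro T ⟨⟨γ, hγ, h0, hγf⟩, hT⟩
        refine ⟨(T, BoundedContinuousFunction.mkOfCompact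
          ⟨fun s : unitInterval => γ s, by fun_prop⟩), ⟨⟨hT, ?_, ?_⟩, ?_, ?_⟩, rfl⟩
        · intro s s'
          change ‖f.eval (γ s) - f.eval (γ s')‖ ≤ _
          rw [hγf s s.2, hγf s' s'.2]
          have : (p + (min (s : ℝ) T : ℝ) * (w - p)) - (p + (min (s' : ℝ) T : ℝ) * (w - p)) =
              ((min (s : ℝ) T - min (s' : ℝ) T : ℝ) : ℂ) * (w - p) := by push_cast; ring
          rw [this, norm_mul, Complex.norm_real, Real.norm_eq_abs, mul_comm]
          refine mul_le_mul_of_nonneg_left ?_ (norm_nonneg _)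
          simpa using abs_min_sub_min_le_max (s : ℝ) T s' T
        · change ‖f.eval (γ ((0 : unitInterval) : ℝ))‖ ≤ _
          simp [h0, hp]
        · change γ ((0 : unitInterval) : ℝ) = z₀
          simp [h0]
        · intro s
          exact hγf s s.2
      · rintro _ ⟨⟨T, γ⟩, ⟨⟨hT, -⟩, h0, hγf⟩, rfl⟩
        refine ⟨⟨fun s => γ (projIcc 0 1 zero_le_one s),
          γ.continuous.comp continuous_projIcc, ?_, fun s hs => ?_⟩, hT⟩
        · rw [← h0]
          exact congrArg γ (projIcc_left _)
        · beta_reduce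
          rw [projIcc_of_mem zero_le_one hs]
          exact hγf ⟨s, hs⟩
    rw [him]
    exact ((hK.inter_right hC).image continuous_fst).isClosed
  have h0S : (0 : ℝ) ∈ S := by
    refine ⟨fun _ => z₀, continuous_const, rfl, fun s hs => ?_⟩
    simp [min_eq_right hs.1, hp]
  have hsub := hcl.Icc_subset_of_forall_exists_gt h0S ?_
  · obtain ⟨γ, hγ, h0, hγf⟩ := hsub (right_mem_Icc.mpr zero_le_one)
    refine ⟨γ, hγ, h0, fun s hs => ?_⟩
    rw [hγf s hs, min_eq_left hs.2]
  · rintro T ⟨⟨γ, hγ, h0, hγf⟩, hT⟩ y hy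
    have hT' : T ∈ Icc (0 : ℝ) 1 := ⟨hT.1, hT.2.le⟩
    obtain ⟨e, hes, he⟩ := exists_openPartialHomeomorph_eval (H T hT' γ hγ h0 hγf)
    have hfT : f.eval (γ T) = p + T * (w - p) := by simpa using hγf T hT'
    have hσ : Continuous fun s : ℝ => p + (s : ℂ) * (w - p) := by fun_prop
    have hnhds : ∀ᶠ s : ℝ in 𝓝 T, p + (s : ℂ) * (w - p) ∈ e.target := by
      refine hσ.continuousAt.eventually_mem (e.open_target.mem_nhds ?_)
      rw [← hfT, ← he]
      exact e.map_source hes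
    obtain ⟨ε, hε, hball⟩ := Metric.eventually_nhds_iff.mp hnhds
    set T' := min y (T + ε / 2)
    have hTT' : T < T' := lt_min hy (by linarith)
    have htar : ∀ s, T ≤ s → s ≤ T' → p + (s : ℂ) * (w - p) ∈ e.target := by
      intro s h1 h2
      apply hball
      have := h2.trans (min_le_right _ _)
      rw [Real.dist_eq, abs_lt]
      constructor <;> linarith
    have hclamp : ∀ s : ℝ, T ≤ max T (min s T') ∧ max T (min s T') ≤ T' := fun s =>
      ⟨le_max_left _ _, max_le hTT'.le (min_le_right _ _)⟩
    refine ⟨T', ⟨fun s => if s ≤ T then γ s else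
      e.symm (p + ((max T (min s T') : ℝ) : ℂ) * (w - p)), ?_, ?_, ?_⟩, hTT', min_le_left _ _⟩
    · refine Continuous.if_le hγ ?_ continuous_id continuous_const ?_
      · refine e.continuousOn_symm.comp_continuous (by fun_prop) fun s => ?_
        exact htar _ (hclamp s).1 (hclamp s).2
      · rintro s rfl
        rw [min_eq_left hTT'.le, max_self, ← hfT, ← he, e.left_inv hes]
    · simp only [hT.1, if_true, h0]
    · intro s hs
      by_cases h : s ≤ T
      · simp only [h, if_true]
        rw [hγf s hs, min_eq_left h, min_eq_left (h.trans hTT'.le)]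
      · simp only [h, if_false]
        rw [← he, e.right_inv (htar _ (hclamp s).1 (hclamp s).2),
          max_eq_right (le_min (not_le.mp h).le hTT'.le)]

theorem continuous_hat (f : ℂ[X]) : Continuous (hat f) :=
  Continuous.subtype_mk (continuous_id.prodMk f.continuous) _

/-- The surface distance is at most the length of the image of a Lipschitz path. -/
theorem surfaceDist_le_of_lipschitz {f : ℂ[X]} {γ : ℝ → ℂ} (hγ : Continuous γ) {L : ℝ}
    (h : ∀ s ∈ Icc (0 : ℝ) 1, ∀ s' ∈ Icc (0 : ℝ) 1,
      ‖f.eval (γ s) - f.eval (γ s')‖ ≤ L * |s - s'|) :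
    surfaceDist (hat f (γ 0)) (hat f (γ 1)) ≤ ENNReal.ofReal L := by
  have hL : 0 ≤ L := by
    simpa using (norm_nonneg _).trans (h 1 (by simp) 0 (by simp))
  let P : Path (hat f (γ 0)) (hat f (γ 1)) :=
    { toFun := fun s => hat f (γ s)
      continuous_toFun := (continuous_hat f).comp (hγ.comp continuous_subtype_val)
      source' := by simp
      target' := by simp }
  refine (iInf_le _ P).trans ?_
  refine iSup_le ?_
  rintro ⟨n, u, hu, -⟩
  calc ∑ i ∈ Finset.range n, edist (proj (P (u (i + 1)))) (proj (P (u i)))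
      ≤ ∑ i ∈ Finset.range n, ENNReal.ofReal (L * ((u (i + 1) : ℝ) - u i)) := by
        refine Finset.sum_le_sum fun i _ => ?_
        rw [edist_dist, dist_eq_norm]
        refine ENNReal.ofReal_le_ofReal ?_
        refine (h _ (u (i + 1)).2 _ (u i).2).trans_eq ?_
        rw [abs_of_nonneg]
        exact sub_nonneg.mpr (hu i.le_succ)
    _ = ENNReal.ofReal (∑ i ∈ Finset.range n, L * ((u (i + 1) : ℝ) - u i)) := by
        rw [ENNReal.ofReal_sum_of_nonneg]
        intro i _
        exact mul_nonneg hL (sub_nonneg.mpr (hu i.le_succ))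
    _ ≤ ENNReal.ofReal L := by
        refine ENNReal.ofReal_le_ofReal ?_
        rw [← Finset.mul_sum, Finset.sum_range_sub (fun i => (u i : ℝ))]
        have h1 := (u n).2.2
        have h2 := (u 0).2.1
        nlinarith

/-- On the disk around `f z₀` free of critical points on the sheet of `z₀`, `f` has an inverse
branch. -/
theorem exists_inverse_branch {f : ℂ[X]} (hf : f.Monic) (hd : 0 < f.natDegree) {z₀ : ℂ} {ρ : ℝ}
    (H : ∀ y, surfaceDist (hat f z₀) (hat f y) < ENNReal.ofReal ρ → f.derivative.eval y ≠ 0) :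
    ∃ g : ℂ → ℂ, ContinuousOn g (Metric.ball (f.eval z₀) ρ) ∧ g (f.eval z₀) = z₀ ∧
      ∀ w ∈ Metric.ball (f.eval z₀) ρ, f.eval (g w) = w ∧ f.derivative.eval (g w) ≠ 0 := by
  set p := f.eval z₀ with hp
  rcases le_or_gt ρ 0 with hρ | hρ
  · refine ⟨fun _ => z₀, continuousOn_const, rfl, fun w hw => ?_⟩
    rw [Metric.ball_eq_empty.mpr hρ] at hw
    exact hw.elim
  have hreg : ∀ w ∈ Metric.ball p ρ, ∀ T ∈ Icc (0 : ℝ) 1, ∀ γ : ℝ → ℂ, Continuous γ → γ 0 = z₀ →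
      (∀ s ∈ Icc (0 : ℝ) 1, f.eval (γ s) = p + (min s T : ℝ) * (w - p)) →
      f.derivative.eval (γ T) ≠ 0 := by
    intro w hw T hT γ hγ h0 hγf
    apply H
    have := surfaceDist_le_of_lipschitz (f := f) (γ := fun s => γ (s * T)) (by fun_prop)
      (L := ‖w - p‖) ?_
    · simp only [zero_mul, one_mul, h0] at this
      refine this.trans_lt ((ENNReal.ofReal_lt_ofReal_iff hρ).mpr ?_)
      rwa [Metric.mem_ball, dist_eq_norm] at hw
    · have hmem : ∀ s ∈ Icc (0 : ℝ) 1, s * T ∈ Icc (0 : ℝ) 1 ∧ min (s * T) T = s * T := by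
        intro s hs
        refine ⟨⟨mul_nonneg hs.1 hT.1, mul_le_one₀ hs.2 hT.1 hT.2⟩, min_eq_left ?_⟩
        exact mul_le_of_le_one_left hT.1 hs.2
      intro s hs s' hs'
      rw [hγf _ (hmem s hs).1, hγf _ (hmem s' hs').1, (hmem s hs).2, (hmem s' hs').2]
      have : p + (s * T : ℝ) * (w - p) - (p + (s' * T : ℝ) * (w - p)) =
          (((s - s') * T : ℝ) : ℂ) * (w - p) := by push_cast; ring
      rw [this, norm_mul, Complex.norm_real, Real.norm_eq_abs, mul_comm, abs_mul, abs_of_nonneg hT.1]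
      have := mul_le_of_le_one_right (abs_nonneg (s - s')) hT.2
      gcongr
  have hlift : ∀ w : Metric.ball p ρ, ∃ γ : ℝ → ℂ, Continuous γ ∧ γ 0 = z₀ ∧
      ∀ s ∈ Icc (0 : ℝ) 1, f.eval (γ s) = p + s * ((w : ℂ) - p) := fun w =>
    exists_segment_lift hf hd (hreg w w.2)
  choose Γ hΓc hΓ0 hΓ using hlift
  have hΓreg : ∀ w, ∀ s ∈ Icc (0 : ℝ) 1, f.derivative.eval (Γ w s) ≠ 0 := by
    intro w s hs
    have := hreg w w.2 s hs (fun t => Γ w (max 0 (min t s)))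
      ((hΓc w).comp (by fun_prop)) ?_ ?_
    · simpa [hs.1] using this
    · simp [hs.1, hΓ0]
    · intro t ht
      have h1 : 0 ≤ min t s := le_min ht.1 hs.1
      rw [max_eq_right h1]
      exact hΓ w _ ⟨h1, (min_le_left _ _).trans ht.2⟩
  let G : unitInterval × Metric.ball p ρ → {z : ℂ // f.derivative.eval z ≠ 0} :=
    fun x => ⟨Γ x.2 x.1, hΓreg x.2 x.1 x.1.2⟩
  have hG : Continuous G := by
    let F : C(unitInterval × Metric.ball p ρ, ℂ) :=
      ⟨fun x => p + ((x.1 : ℝ) : ℂ) * ((x.2 : ℂ) - p), by fun_prop⟩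
    refine (isLocalHomeomorph_eval_regular f).continuous_lift (isSeparatedMap_eval_regular f)
      F (g := G) ?_ ?_ ?_
    · ext x
      exact hΓ x.2 x.1 x.1.2
    · have : (fun w : Metric.ball p ρ => G (0, w)) = fun w =>
          ⟨z₀, by simpa [hΓ0] using hΓreg w 0 (by simp)⟩ := by
        ext w
        simp [G, hΓ0]
      rw [this]
      exact continuous_const.subtype_mk _
    · intro w
      exact ((hΓc w).comp continuous_subtype_val).subtype_mk _
  classical
  refine ⟨fun w => if hw : w ∈ Metric.ball p ρ then Γ ⟨w, hw⟩ 1 else z₀, ?_, ?_, ?_⟩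
  · rw [continuousOn_iff_continuous_domRestrict]
    have : (Metric.ball p ρ).domRestrict
        (fun w => if hw : w ∈ Metric.ball p ρ then Γ ⟨w, hw⟩ 1 else z₀) =
        fun w => (G (1, w) : ℂ) := by
      ext ⟨w, hw⟩
      simp only [domRestrict_apply, hw, dif_pos, G]
      simp
    rw [this]
    exact continuous_subtype_val.comp (hG.comp (by fun_prop))
  · have hpb : p ∈ Metric.ball p ρ := Metric.mem_ball_self hρ
    simp only [hpb, dif_pos]
    have := eqOn_of_eval_eqOn (f := f) (isPreconnected_Icc (a := (0 : ℝ)) (b := 1))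
      (g := Γ ⟨p, hpb⟩) (g' := fun _ => z₀) (hΓc _).continuousOn continuousOn_const ?_
      (hΓreg _) (left_mem_Icc.mpr zero_le_one) (hΓ0 _)
    · exact this (right_mem_Icc.mpr zero_le_one)
    · intro s hs
      simp [hΓ _ s hs, hp]
  · intro w hw
    simp only [hw, dif_pos]
    refine ⟨?_, hΓreg _ 1 (by simp)⟩
    rw [hΓ _ 1 (by simp)]
    simp

/-- The point of the source plane under a point of the surface. -/
def sourcePoint {f : ℂ[X]} (u : BranchedCover f) : ℂ := u.1.1

theorem sourcePoint_hat {f : ℂ[X]} (z : ℂ) : sourcePoint (hat f z) = z := rfl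

theorem hat_sourcePoint {f : ℂ[X]} (u : BranchedCover f) : hat f (sourcePoint u) = u :=
  Subtype.ext (Prod.ext rfl u.2.symm)

theorem eval_sourcePoint {f : ℂ[X]} (u : BranchedCover f) : f.eval (sourcePoint u) = proj u :=
  u.2.symm

theorem proj_hat {f : ℂ[X]} (z : ℂ) : proj (hat f z) = f.eval z := rfl

theorem continuous_sourcePoint {f : ℂ[X]} : Continuous (sourcePoint (f := f)) :=
  continuous_fst.comp continuous_subtype_val

/-- Points close to each other on the surface are close to each other in the source plane. -/
theorem norm_sub_le_of_surfaceDist_lt {f : ℂ[X]} (hf : f.Monic) (hd : 0 < f.natDegree) {z z' : ℂ}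
    {η : ℝ} (h : surfaceDist (hat f z) (hat f z') < ENNReal.ofReal η) :
    ‖z - z'‖ ≤ liftModulus f.natDegree η := by
  obtain ⟨γ, hγ⟩ := iInf_lt_iff.mp h
  have hc : Continuous fun s => sourcePoint (γ s) := continuous_sourcePoint.comp γ.continuous
  refine norm_sub_le_liftModulus hf hd (isPreconnected_range hc) (w := f.eval z) ?_
    ⟨0, by simp [sourcePoint_hat]⟩ ⟨1, by simp [sourcePoint_hat]⟩
  rintro _ ⟨s, rfl⟩
  have h1 := (eVariationOn.edist_le (fun s => proj (γ s)) (mem_univ s) (mem_univ 0)).trans_lt hγ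
  rw [edist_dist, ENNReal.ofReal_lt_ofReal_iff_of_nonneg dist_nonneg, dist_eq_norm] at h1
  rw [γ.source] at h1
  rw [eval_sourcePoint]
  exact h1.le

theorem surfaceDist_triangle {f : ℂ[X]} (u v w : BranchedCover f) :
    surfaceDist u w ≤ surfaceDist u v + surfaceDist v w := by
  refine ENNReal.le_of_forall_pos_le_add fun ε hε hfin => ?_
  have hfin' := ENNReal.add_lt_top.mp hfin
  have hε' : (ε : ℝ≥0∞) / 2 ≠ 0 := by simpa using hε.ne'
  obtain ⟨γ, hγ⟩ := iInf_lt_iff.mp (ENNReal.lt_add_right hfin'.1.ne hε')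
  obtain ⟨γ', hγ'⟩ := iInf_lt_iff.mp (ENNReal.lt_add_right hfin'.2.ne hε')
  have hlen : pathLength (γ.trans γ') ≤ pathLength γ + pathLength γ' := by
    set m : unitInterval := ⟨1 / 2, by norm_num, by norm_num⟩
    have hm : ∀ s : unitInterval, s ≤ m ↔ (s : ℝ) ≤ 1 / 2 := fun s => Iff.rfl
    have hm' : ∀ s : unitInterval, m ≤ s ↔ 1 / 2 ≤ (s : ℝ) := fun s => Iff.rfl
    have h0 : (univ : Set unitInterval) = Iic m ∪ Ici m := by simp
    unfold pathLength
    rw [h0, eVariationOn.union _ isGreatest_Iic isLeast_Ici, ← h0]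
    gcongr
    · have heq : EqOn (fun s => proj ((γ.trans γ') s))
          ((fun s => proj (γ s)) ∘ fun s : unitInterval => projIcc 0 1 zero_le_one (2 * (s : ℝ)))
          (Iic m) := by
        intro s hs
        simp only [Path.trans_apply, Function.comp_apply]
        have hs' : (s : ℝ) ≤ 1 / 2 := hs
        rw [dif_pos hs', projIcc_of_mem zero_le_one ⟨by linarith [s.2.1], by linarith⟩]
      rw [eVariationOn.eq_of_eqOn heq]
      refine eVariationOn.comp_le_of_monotoneOn _ _ ?_ (mapsTo_univ _ _)
      intro a _ b _ hab
      exact monotone_projIcc _ (by simpa using hab)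
    · have heq : EqOn (fun s => proj ((γ.trans γ') s))
          ((fun s => proj (γ' s)) ∘
            fun s : unitInterval => projIcc 0 1 zero_le_one (2 * (s : ℝ) - 1)) (Ici m) := by
        intro s hs
        have hs' : 1 / 2 ≤ (s : ℝ) := hs
        simp only [Path.trans_apply, Function.comp_apply]
        rcases hs'.eq_or_lt with h | h
        · rw [dif_pos h.ge]
          have e1 : (⟨2 * (s : ℝ), (unitInterval.mul_pos_mem_iff zero_lt_two).2 ⟨s.2.1, h.ge⟩⟩ :
              unitInterval) = 1 := Subtype.ext (by simp [← h])
          have e2 : projIcc (0 : ℝ) 1 zero_le_one (2 * (s : ℝ) - 1) = 0 :=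
            projIcc_of_le_left _ (by linarith)
          rw [e1, e2, γ.target, γ'.source]
        · rw [dif_neg (not_le.mpr h),
            projIcc_of_mem zero_le_one ⟨by linarith, by linarith [s.2.2]⟩]
      rw [eVariationOn.eq_of_eqOn heq]
      refine eVariationOn.comp_le_of_monotoneOn _ _ ?_ (mapsTo_univ _ _)
      intro a _ b _ hab
      exact monotone_projIcc _ (by simpa using hab)
  calc surfaceDist u w ≤ pathLength (γ.trans γ') := iInf_le _ _
    _ ≤ pathLength γ + pathLength γ' := hlen
    _ ≤ (surfaceDist u v + ε / 2) + (surfaceDist v w + ε / 2) := by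
        gcongr <;> exact le_of_lt ‹_›
    _ = surfaceDist u v + surfaceDist v w + ε := by
        rw [add_add_add_comm, ENNReal.add_halves]

/-- On bounded sets the surface distance is controlled by the distance in the source plane. -/
theorem exists_surfaceDist_le (f : ℂ[X]) (R : ℝ) : ∃ K : ℝ, ∀ z ∈ Metric.closedBall (0 : ℂ) R,
    ∀ z' ∈ Metric.closedBall (0 : ℂ) R,
      surfaceDist (hat f z) (hat f z') ≤ ENNReal.ofReal (K * ‖z' - z‖) := by
  obtain ⟨K, hK⟩ := (isCompact_closedBall (0 : ℂ) R).exists_bound_of_continuousOn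
    (f := fun z => f.derivative.eval z) f.derivative.continuous.continuousOn
  refine ⟨K, fun z hz z' hz' => ?_⟩
  have hconv := convex_closedBall (0 : ℂ) R
  have := surfaceDist_le_of_lipschitz (f := f) (γ := fun s : ℝ => z + (s : ℂ) * (z' - z))
    (by fun_prop) (L := K * ‖z' - z‖) ?_
  · simpa using this
  · have hmem : ∀ s ∈ Icc (0 : ℝ) 1, z + (s : ℂ) * (z' - z) ∈ Metric.closedBall (0 : ℂ) R := by
      intro s hs
      have := hconv.add_smul_sub_mem hz hz' hs
      simpa using this
    intro s hs s' hs'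
    have h1 := hconv.norm_image_sub_le_of_norm_hasDerivWithin_le
      (f := fun z => f.eval z) (fun x _ => (f.hasDerivAt x).hasDerivWithinAt) hK (hmem s' hs')
      (hmem s hs)
    refine h1.trans_eq ?_
    have : z + (s : ℂ) * (z' - z) - (z + (s' : ℂ) * (z' - z)) =
        ((s - s' : ℝ) : ℂ) * (z' - z) := by push_cast; ring
    rw [this, norm_mul, Complex.norm_real, Real.norm_eq_abs]
    ring

theorem surfaceDist_ne_top {f : ℂ[X]} (z z' : ℂ) : surfaceDist (hat f z) (hat f z') ≠ ⊤ := by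
  obtain ⟨K, hK⟩ := exists_surfaceDist_le f (max ‖z‖ ‖z'‖)
  exact ((hK z (by simp) z' (by simp)).trans_lt ENNReal.ofReal_lt_top).ne

theorem continuous_surfaceDist {f : ℂ[X]} (c : ℂ) :
    Continuous fun z => (surfaceDist (hat f z) (hat f c)).toReal := by
  rw [continuous_iff_continuousAt]
  intro z
  obtain ⟨K, hK⟩ := exists_surfaceDist_le f (‖z‖ + 1)
  have hz : z ∈ Metric.closedBall (0 : ℂ) (‖z‖ + 1) := by simp
  have key : ∀ y ∈ Metric.closedBall (0 : ℂ) (‖z‖ + 1), ∀ y' ∈ Metric.closedBall (0 : ℂ) (‖z‖ + 1),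
      (surfaceDist (hat f y) (hat f c)).toReal - (surfaceDist (hat f y') (hat f c)).toReal ≤
        |K| * ‖y' - y‖ := by
    intro y hy y' hy'
    have h1 := surfaceDist_triangle (hat f y) (hat f y') (hat f c)
    have h2 := ENNReal.toReal_mono
      (ENNReal.add_ne_top.mpr ⟨surfaceDist_ne_top _ _, surfaceDist_ne_top _ _⟩) h1
    rw [ENNReal.toReal_add (surfaceDist_ne_top _ _) (surfaceDist_ne_top _ _)] at h2
    have h3 := ENNReal.toReal_mono ENNReal.ofReal_ne_top
      ((hK y hy y' hy').trans (ENNReal.ofReal_le_ofReal (mul_le_mul_of_nonneg_right (le_abs_self K)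
        (norm_nonneg (y' - y)))))
    rw [ENNReal.toReal_ofReal (by positivity)] at h3
    linarith
  have hev : ∀ᶠ y in 𝓝 z, y ∈ Metric.closedBall (0 : ℂ) (‖z‖ + 1) := by
    have : {y : ℂ | ‖y‖ < ‖z‖ + 1} ∈ 𝓝 z :=
      (isOpen_lt continuous_norm continuous_const).mem_nhds (by simp)
    filter_upwards [this] with y hy
    simpa using le_of_lt hy
  refine tendsto_iff_dist_tendsto_zero.mpr ?_
  refine squeeze_zero' (g := fun y => |K| * ‖y - z‖) (Eventually.of_forall fun _ => dist_nonneg)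
    ?_ ?_
  · filter_upwards [hev] with y hy
    rw [Real.dist_eq, abs_le]
    have h1 := key y hy z hz
    have h2 := key z hz y hy
    rw [norm_sub_rev] at h1
    constructor <;> linarith
  · have : Continuous fun y => |K| * ‖y - z‖ := by fun_prop
    simpa using this.tendsto z

/-- The Voronoi domains are closed. -/
theorem isClosed_voronoi (f : ℂ[X]) (c : ℂ) : IsClosed {z | hat f z ∈ voronoi (hat f c)} := by
  have : {z | hat f z ∈ voronoi (hat f c)} = ⋂ c' ∈ criticalPoints f,
      {z | (surfaceDist (hat f z) (hat f c)).toReal ≤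
        (surfaceDist (hat f z) (hat f c')).toReal} := by
    ext z
    simp only [voronoi, mem_ofPred_eq, mem_iInter]
    refine forall₂_congr fun c' _ => ?_
    rw [ENNReal.toReal_le_toReal (surfaceDist_ne_top _ _) (surfaceDist_ne_top _ _)]
  rw [this]
  exact isClosed_biInter fun c' _ =>
    isClosed_le (continuous_surfaceDist c) (continuous_surfaceDist c')

/-- Influence in terms of lifted segments in the source plane. -/
theorem influences_iff {f : ℂ[X]} {c z : ℂ} : Influences f c z ↔
    ∃ γ : ℝ → ℂ, Continuous γ ∧ γ 1 = z ∧ (∀ s ∈ Icc (0 : ℝ) 1, f.eval (γ s) = s * f.eval z) ∧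
      ∃ s ∈ Icc (0 : ℝ) 1, hat f (γ s) ∈ voronoi (hat f c) := by
  constructor
  · rintro ⟨o, ho, u, ⟨γ, hγ, s, rfl⟩, hu⟩
    have hc : Continuous fun s => sourcePoint (γ s) :=
      continuous_sourcePoint.comp γ.continuous
    refine ⟨fun s => sourcePoint (γ (projIcc 0 1 zero_le_one s)), hc.comp continuous_projIcc, ?_, ?_,
      s, s.2, ?_⟩
    · have : projIcc (0 : ℝ) 1 zero_le_one 1 = 1 := projIcc_right _
      simp only [this, γ.target, sourcePoint_hat]
    · intro s hs
      have h1 := hγ ⟨s, hs⟩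
      rw [ho, AffineMap.lineMap_apply_module'] at h1
      beta_reduce
      rw [projIcc_of_mem zero_le_one hs, eval_sourcePoint, h1]
      simp [proj_hat]
    · beta_reduce
      rw [projIcc_val, hat_sourcePoint]
      exact hu
  · rintro ⟨γ, hγ, rfl, hγf, s, hs, hv⟩
    refine ⟨hat f (γ 0), ?_, hat f (γ s), ⟨⟨⟨fun s => hat f (γ s), ?_⟩, ?_, ?_⟩, ?_, ⟨s, hs⟩, rfl⟩,
      hv⟩
    · change f.eval (γ 0) = 0
      simpa using hγf 0 (by simp)
    · exact (continuous_hat f).comp (hγ.comp continuous_subtype_val)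
    · simp
    · simp
    · intro s
      have h0 : f.eval (γ 0) = 0 := by simpa using hγf 0 (by simp)
      change f.eval (γ s) = AffineMap.lineMap (f.eval (γ 0)) (f.eval (γ 1)) (s : ℝ)
      rw [hγf s s.2, AffineMap.lineMap_apply_module', h0]
      simp

theorem continuous_startPoint (r : ℝ) : Continuous (startPoint r) := by
  unfold startPoint
  fun_prop

/-- The times at which a critical point has influence form a closed set. -/
theorem isClosed_setOf_influences {f : ℂ[X]} (hf : f.Monic) (hd : 0 < f.natDegree) (r : ℝ)
    (c : ℂ) : IsClosed {t | t ∈ Icc (0 : ℝ) 1 ∧ Influences f c (startPoint r t)} := by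
  have hz := continuous_startPoint r
  obtain ⟨M, hM⟩ := (isCompact_Icc (a := (0 : ℝ)) (b := 1)).exists_bound_of_continuousOn
    (f.continuous.comp hz).continuousOn
  set K := {γ : BoundedContinuousFunction unitInterval ℂ |
    (∀ s s' : unitInterval, ‖f.eval (γ s) - f.eval (γ s')‖ ≤ M * |(s : ℝ) - s'|) ∧
      ‖f.eval (γ 0)‖ ≤ 0} with hKdef
  have hK := ((isCompact_Icc (a := (0 : ℝ)) (b := 1)).prod
    (isCompact_lipschitz_lifts hf hd M 0)).prod (isCompact_univ (X := unitInterval))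
  set W : Set ((ℝ × BoundedContinuousFunction unitInterval ℂ) × unitInterval) :=
    {x | x.1.2 1 = startPoint r x.1.1} ∩ {x | hat f (x.1.2 x.2) ∈ voronoi (hat f c)} ∩
      ⋂ s : unitInterval, {x | f.eval (x.1.2 s) = ((s : ℝ) : ℂ) * f.eval (startPoint r x.1.1)}
  have hev : ∀ s : unitInterval, Continuous
      fun x : (ℝ × BoundedContinuousFunction unitInterval ℂ) × unitInterval => x.1.2 s :=
    fun s => (continuous_eval_const s).comp (continuous_snd.comp continuous_fst)
  have hev' : Continuous
      fun x : (ℝ × BoundedContinuousFunction unitInterval ℂ) × unitInterval => x.1.2 x.2 := by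
    fun_prop
  have ht : Continuous
      fun x : (ℝ × BoundedContinuousFunction unitInterval ℂ) × unitInterval =>
        startPoint r x.1.1 := hz.comp (continuous_fst.comp continuous_fst)
  have hW : IsClosed W := by
    refine ((isClosed_eq (hev 1) ht).inter ((isClosed_voronoi f c).preimage hev')).inter
      (isClosed_iInter fun s => isClosed_eq (f.continuous.comp (hev s)) ?_)
    exact continuous_const.mul (f.continuous.comp ht)
  have him : {t | t ∈ Icc (0 : ℝ) 1 ∧ Influences f c (startPoint r t)} =
      (fun x => x.1.1) '' ((Icc (0 : ℝ) 1 ×ˢ K) ×ˢ univ ∩ W) := by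
    refine Subset.antisymm ?_ ?_
    · rintro t ⟨ht, hinf⟩
      obtain ⟨γ, hγ, h1, hγf, s, hs, hv⟩ := influences_iff.mp hinf
      refine ⟨((t, BoundedContinuousFunction.mkOfCompact
        ⟨fun s : unitInterval => γ s, by fun_prop⟩), ⟨s, hs⟩), ⟨⟨⟨ht, ?_, ?_⟩, mem_univ _⟩,
        ⟨?_, ?_⟩, ?_⟩, rfl⟩
      · intro s s'
        change ‖f.eval (γ s) - f.eval (γ s')‖ ≤ _
        rw [hγf s s.2, hγf s' s'.2, ← sub_mul, ← Complex.ofReal_sub, norm_mul, Complex.norm_real,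
          Real.norm_eq_abs, mul_comm]
        exact mul_le_mul_of_nonneg_right (hM t ht) (abs_nonneg _)
      · change ‖f.eval (γ ((0 : unitInterval) : ℝ))‖ ≤ _
        rw [hγf _ (Subtype.prop _)]
        simp
      · change γ ((1 : unitInterval) : ℝ) = _
        simpa using h1
      · exact hv
      · refine mem_iInter.mpr fun s => ?_
        exact hγf s s.2
    · rintro _ ⟨⟨⟨t, γ⟩, s⟩, ⟨⟨⟨ht, -⟩, -⟩, ⟨h1, hv⟩, hγf⟩, rfl⟩
      refine ⟨ht, influences_iff.mpr ⟨fun s => γ (projIcc 0 1 zero_le_one s),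
          γ.continuous.comp continuous_projIcc, ?_, fun s hs => ?_, s, s.2, ?_⟩⟩
      · exact (congrArg γ (projIcc_right _)).trans h1
      · beta_reduce
        rw [projIcc_of_mem zero_le_one hs]
        exact mem_iInter.mp hγf ⟨s, hs⟩
      · beta_reduce
        rw [projIcc_val]
        exact hv
  rw [him]
  exact ((hK.inter_right hW).image (by fun_prop)).isClosed

/-- The inverse branch around a point of a Voronoi domain: its disk of definition reaches exactly
to the critical value, where the branch takes the critical point as its limit. -/
theorem exists_branch_of_mem_voronoi {f : ℂ[X]} (hf : f.Monic) (hd : 0 < f.natDegree) {z₀ c : ℂ}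
    (hc : c ∈ criticalPoints f) (hz : hat f z₀ ∈ voronoi (hat f c))
    (hz₀ : f.derivative.eval z₀ ≠ 0) :
    ∃ ρ > 0, ∃ g : ℂ → ℂ, ContinuousOn g (Metric.ball (f.eval z₀) ρ) ∧ g (f.eval z₀) = z₀ ∧
      (∀ w ∈ Metric.ball (f.eval z₀) ρ, f.eval (g w) = w ∧ f.derivative.eval (g w) ≠ 0) ∧
      dist (f.eval c) (f.eval z₀) = ρ ∧
      ∀ w ∈ Metric.ball (f.eval z₀) ρ, ‖g w - c‖ ≤ liftModulus f.natDegree ‖w - f.eval c‖ := by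
  set p := f.eval z₀ with hp
  set ρ := (surfaceDist (hat f z₀) (hat f c)).toReal with hρ
  have hcc : f.derivative.eval c = 0 := hc
  have hDρ : surfaceDist (hat f z₀) (hat f c) = ENNReal.ofReal ρ :=
    (ENNReal.ofReal_toReal (surfaceDist_ne_top _ _)).symm
  have hmod : Tendsto (liftModulus f.natDegree) (𝓝 0) (𝓝 0) := by
    simpa [liftModulus_zero hd] using (continuous_liftModulus f.natDegree).tendsto 0
  have hρ0 : 0 < ρ := by
    refine lt_of_le_of_ne ENNReal.toReal_nonneg fun h0 => ?_
    have h1 : ∀ η > 0, ‖z₀ - c‖ ≤ liftModulus f.natDegree η := fun η hη =>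
      norm_sub_le_of_surfaceDist_lt hf hd (by rw [hDρ, ← h0]; simpa using hη)
    have h2 : ‖z₀ - c‖ ≤ 0 := ge_of_tendsto (hmod.mono_left nhdsWithin_le_nhds)
      (eventually_mem_nhdsWithin.mono fun η (hη : η ∈ Ioi 0) => h1 η hη)
    rw [norm_le_zero_iff, sub_eq_zero] at h2
    exact hz₀ (h2 ▸ hcc)
  obtain ⟨g, hg, hg0, hgf⟩ := exists_inverse_branch hf hd (z₀ := z₀) (ρ := ρ) fun y hy hcrit => by
    have := hz y hcrit
    rw [hDρ] at this
    exact absurd hy (not_lt.mpr this)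
  rw [← hp] at hg hg0 hgf
  have hmodg : ∀ w ∈ Metric.ball p ρ, ∀ w' ∈ Metric.ball p ρ,
      ‖g w - g w'‖ ≤ liftModulus f.natDegree ‖w - w'‖ := by
    intro w hw w' hw'
    have hseg : segment ℝ w w' ⊆ Metric.ball p ρ := (convex_ball p ρ).segment_subset hw hw'
    refine norm_sub_le_liftModulus hf hd (K := g '' segment ℝ w w') (w := w) ?_ ?_
      (mem_image_of_mem _ (left_mem_segment ℝ w w')) (mem_image_of_mem _ (right_mem_segment ℝ w w'))
    · exact (convex_segment w w').isPreconnected.image _ (hg.mono hseg)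
    · rintro _ ⟨y, hy, rfl⟩
      rw [(hgf y (hseg hy)).1, ← dist_eq_norm, ← dist_eq_norm, dist_comm y]
      have := mem_segment_iff_wbtw.mp hy
      have := this.dist_add_dist
      linarith [dist_nonneg (x := y) (y := w')]
  have happ : ∀ ε > 0, ∃ w ∈ Metric.ball p ρ, ‖g w - c‖ ≤ liftModulus f.natDegree ε + ε := by
    intro ε hε
    have hlt : surfaceDist (hat f z₀) (hat f c) < ENNReal.ofReal (ρ + ε) := by
      rw [hDρ, ENNReal.ofReal_lt_ofReal_iff (by positivity)]
      linarith
    obtain ⟨γ, hγ⟩ := iInf_lt_iff.mp hlt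
    have hyc : Continuous fun s => sourcePoint (γ s) := continuous_sourcePoint.comp γ.continuous
    have hqc : Continuous fun s => f.eval (sourcePoint (γ s)) := f.continuous.comp hyc
    set y : unitInterval → ℂ := fun s => sourcePoint (γ s) with hy
    have hy0 : y 0 = z₀ := by simp [hy, sourcePoint_hat]
    have hy1 : y 1 = c := by simp [hy, sourcePoint_hat]
    have hagree : ∀ J : Set unitInterval, IsPreconnected J → 0 ∈ J →
        (∀ s ∈ J, f.eval (y s) ∈ Metric.ball p ρ) → ∀ s ∈ J, g (f.eval (y s)) = y s := by
      intro J hJ h0 hJb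
      refine eqOn_of_eval_eqOn (f := f) hJ (hg.comp hqc.continuousOn hJb) hyc.continuousOn
        (fun s hs => (hgf _ (hJb s hs)).1) (fun s hs => (hgf _ (hJb s hs)).2) h0 ?_
      rw [hy0, ← hp, hg0]
    set S : Set unitInterval := {s | f.eval (y s) ∉ Metric.ball p ρ}
    have hScl : IsClosed S := (Metric.isOpen_ball.preimage hqc).isClosed_compl
    have hSne : S.Nonempty := by
      by_contra hS
      have hall : ∀ s, f.eval (y s) ∈ Metric.ball p ρ := fun s => by
        by_contra h
        exact hS ⟨s, h⟩
      have h1 := hagree univ isPreconnected_univ (mem_univ _) (fun s _ => hall s) 1 (mem_univ _)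
      have h2 := (hgf _ (hall 1)).2
      rw [h1, hy1] at h2
      exact h2 hcc
    obtain ⟨τ, hτS, hτmin⟩ := hScl.isCompact.exists_isLeast hSne
    have hτ0 : (0 : unitInterval) < τ := by
      refine lt_of_le_of_ne unitInterval.nonneg' fun h0 => hτS ?_
      rw [← h0, hy0]
      exact Metric.mem_ball_self hρ0
    have hbefore : ∀ s ∈ Iio τ, f.eval (y s) ∈ Metric.ball p ρ := by
      intro s hs
      by_contra h
      exact absurd (hτmin h) (not_le.mpr hs)
    have hτρ : ρ ≤ dist (f.eval (y τ)) p := by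
      simpa [S] using hτS
    have hafter : ∀ s ∈ Ici τ, ‖f.eval (y s) - f.eval (y τ)‖ ≤ ε := by
      intro s hs
      have h1 := eVariationOn.add_le_union (fun s => proj (γ s)) (s := Iic τ) (t := Ici τ)
        (fun a ha b hb => le_trans ha hb)
      have h2 := eVariationOn.edist_le (fun s => proj (γ s)) (s := Iic τ) (x := τ) (y := 0)
        self_mem_Iic hτ0.le
      have h3 := eVariationOn.edist_le (fun s => proj (γ s)) (s := Ici τ) (x := s) (y := τ)
        hs self_mem_Ici
      have h4 := ((add_le_add h2 h3).trans (h1.trans (eVariationOn.mono _ (subset_univ _)))).trans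
        hγ.le
      rw [edist_dist, edist_dist, ← ENNReal.ofReal_add dist_nonneg dist_nonneg,
        ENNReal.ofReal_le_ofReal_iff (by positivity)] at h4
      simp only [← eval_sourcePoint] at h4
      change dist (f.eval (y τ)) (f.eval (y 0)) + dist (f.eval (y s)) (f.eval (y τ)) ≤ _ at h4
      rw [hy0, ← hp] at h4
      rw [← dist_eq_norm]
      linarith
    have hend : ‖y τ - c‖ ≤ liftModulus f.natDegree ε := by
      refine norm_sub_le_liftModulus hf hd (K := y '' Ici τ) (w := f.eval (y τ)) ?_ ?_
        (mem_image_of_mem _ self_mem_Ici) ⟨1, unitInterval.le_one', hy1⟩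
      · exact isPreconnected_Ici.image _ hyc.continuousOn
      · rintro _ ⟨s, hs, rfl⟩
        exact hafter s hs
    have hnear : ∃ s ∈ Iio τ, ‖y s - y τ‖ < ε := by
      have h1 : ∀ᶠ s in 𝓝[<] τ, ‖y s - y τ‖ < ε := by
        have := (hyc.tendsto τ).mono_left (nhdsWithin_le_nhds (s := Iio τ))
        have := Metric.tendsto_nhds.mp this ε hε
        simpa [dist_eq_norm] using this
      have : (𝓝[<] τ).NeBot := nhdsLT_neBot_of_exists_lt ⟨0, hτ0⟩
      exact (h1.and eventually_mem_nhdsWithin).exists.imp fun s hs => ⟨hs.2, hs.1⟩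
    obtain ⟨s, hs, hsτ⟩ := hnear
    refine ⟨f.eval (y s), hbefore s hs, ?_⟩
    rw [hagree (Iio τ) isPreconnected_Iio hτ0 hbefore s hs]
    calc ‖y s - c‖ ≤ ‖y s - y τ‖ + ‖y τ - c‖ := norm_sub_le_norm_sub_add_norm_sub _ _ _
      _ ≤ _ := by linarith
  have hseq : ∃ u : ℕ → ℂ, (∀ n, u n ∈ Metric.ball p ρ) ∧ Tendsto (fun n => g (u n)) atTop (𝓝 c) := by
    choose u hu huc using fun n : ℕ => happ (1 / ((n : ℝ) + 1)) (by positivity)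
    refine ⟨u, hu, ?_⟩
    rw [tendsto_iff_norm_sub_tendsto_zero]
    refine squeeze_zero (fun _ => norm_nonneg _) huc ?_
    have h1 := tendsto_one_div_add_atTop_nhds_zero_nat (𝕜 := ℝ)
    simpa using (hmod.comp h1).add h1
  obtain ⟨u, hu, huc⟩ := hseq
  have huq : Tendsto u atTop (𝓝 (f.eval c)) := by
    have := (f.continuous.tendsto c).comp huc
    refine this.congr fun n => ?_
    exact (hgf _ (hu n)).1
  have hbound : ∀ w ∈ Metric.ball p ρ, ‖g w - c‖ ≤ liftModulus f.natDegree ‖w - f.eval c‖ := by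
    intro w hw
    refine le_of_tendsto_of_tendsto' (tendsto_const_nhds.sub huc).norm
      (((continuous_liftModulus f.natDegree).tendsto _).comp (tendsto_const_nhds.sub huq).norm)
      fun n => hmodg w hw (u n) (hu n)
  refine ⟨ρ, hρ0, g, hg, hg0, hgf, le_antisymm ?_ (not_lt.mp fun hlt => ?_), hbound⟩
  · exact le_of_tendsto (huq.dist tendsto_const_nhds)
      (Eventually.of_forall fun n => (Metric.mem_ball.mp (hu n)).le)
  · have h1 := hbound (f.eval c) hlt
    rw [sub_self, norm_zero, liftModulus_zero hd, norm_le_zero_iff, sub_eq_zero] at h1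
    have h2 := (hgf (f.eval c) hlt).2
    rw [h1] at h2
    exact h2 hcc

theorem monic_finProd_X_sub_C {d : ℕ} (ζ : Fin d → ℂ) : (∏ j, (X - C (ζ j))).Monic :=
  monic_prod_of_monic _ _ fun j _ => monic_X_sub_C _

theorem natDegree_finProd_X_sub_C {d : ℕ} (ζ : Fin d → ℂ) :
    (∏ j, (X - C (ζ j))).natDegree = d := by
  rw [natDegree_prod_of_monic _ _ fun j _ => monic_X_sub_C _]
  simp

/-- A root of `f = x` that is the common limit of `N` distinct nearby roots has multiplicity at
least `N`. -/
theorem card_le_rootMultiplicity_of_tendsto {f : ℂ[X]} (hf : f.Monic) (hd : 0 < f.natDegree)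
    {ι : Type*} [Fintype ι] {l : Filter ℝ} [l.NeBot] {x : ℝ → ℂ} {q c : ℂ}
    (hx : Tendsto x l (𝓝 q)) {G : ι → ℝ → ℂ} (hG : ∀ i, Tendsto (G i) l (𝓝 c))
    (hinj : ∀ᶠ ε in l, Function.Injective fun i => G i ε)
    (hroot : ∀ᶠ ε in l, ∀ i, f.eval (G i ε) = x ε) :
    Fintype.card ι ≤ (f - C q).rootMultiplicity c := by
  classical
  set N := Fintype.card ι with hN
  set d := f.natDegree with hdd
  have hne : ∀ w : ℂ, f - C w ≠ 0 := by
    intro w h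
    have := natDegree_sub_C (p := f) (a := w)
    rw [h, natDegree_zero] at this
    omega
  obtain ⟨R, hR0, hR⟩ := exists_norm_le_of_norm_eval_le hf hd (‖q‖ + 1)
  have hprod : ∀ (s : Multiset ℂ) (h : ℂ → ℝ) (B : ℝ), (∀ a ∈ s, 0 ≤ h a ∧ h a ≤ B) →
      (s.map h).prod ≤ B ^ s.card := by
    intro s h B
    induction s using Multiset.induction_on with
    | empty => simp
    | cons a s ih =>
      intro hs
      have h1 := hs a (by simp)
      have h2 := ih fun b hb => hs b (by simp [hb])
      rw [Multiset.map_cons, Multiset.prod_cons, Multiset.card_cons, pow_succ']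
      refine mul_le_mul h1.2 h2 (Multiset.prod_nonneg ?_) (h1.1.trans h1.2)
      intro b hb
      obtain ⟨b, hb', rfl⟩ := Multiset.mem_map.mp hb
      exact (hs b (Multiset.mem_cons_of_mem hb')).1
  have hbound : ∀ y : ℂ, ‖f.eval y - q‖ ≤ ‖y - c‖ ^ N * (‖y‖ + R) ^ (d - N) := by
    intro y
    have hx1 : ∀ᶠ ε in l, ‖x ε‖ ≤ ‖q‖ + 1 := by
      filter_upwards [hx.norm.eventually_lt_const (lt_add_one ‖q‖)] with ε hε using hε.le
    have hlim : Tendsto (fun ε => (∏ i, ‖y - G i ε‖) * (‖y‖ + R) ^ (d - N)) l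
        (𝓝 (‖y - c‖ ^ N * (‖y‖ + R) ^ (d - N))) := by
      refine Tendsto.mul_const _ ?_
      have : ‖y - c‖ ^ N = ∏ _i : ι, ‖y - c‖ := by simp [hN]
      rw [this]
      exact tendsto_finsetProd _ fun i _ => (tendsto_const_nhds.sub (hG i)).norm
    refine le_of_tendsto_of_tendsto (tendsto_const_nhds.sub hx).norm hlim ?_
    filter_upwards [hinj, hroot, hx1] with ε h1 h2 h3
    set m : Multiset ℂ := (Finset.univ : Finset ι).val.map fun i => G i ε with hm
    have hmle : m ≤ (f - C (x ε)).roots := by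
      rw [Multiset.le_iff_subset (Multiset.Nodup.map h1 Finset.univ.nodup)]
      intro a ha
      obtain ⟨i, -, rfl⟩ := Multiset.mem_map.mp ha
      rw [mem_roots (hne _)]
      simp [h2 i]
    have hsplit : (f - C (x ε)).roots = m + ((f - C (x ε)).roots - m) :=
      (add_tsub_cancel_of_le hmle).symm
    have hcard : ((f - C (x ε)).roots - m).card = d - N := by
      rw [Multiset.card_sub hmle, card_roots_sub_C_eq_natDegree]
      simp [hm, hN, hdd]
    rw [norm_eval_sub_eq_prod hf hd, hsplit, Multiset.map_add, Multiset.prod_add, ← hcard]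
    have e1 : (m.map fun a => ‖y - a‖).prod = ∏ i, ‖y - G i ε‖ := by
      rw [hm, Multiset.map_map]
      rfl
    rw [e1]
    refine mul_le_mul_of_nonneg_left (hprod _ _ _ fun a ha => ⟨norm_nonneg _, ?_⟩)
      (Finset.prod_nonneg fun i _ => norm_nonneg _)
    have ha' : a ∈ (f - C (x ε)).roots := Multiset.mem_of_le tsub_le_self ha
    rw [mem_roots (hne _)] at ha'
    have ha'' : f.eval a = x ε := by simpa [sub_eq_zero] using ha'
    exact (norm_sub_le _ _).trans (by linarith [hR a (by rw [ha'']; exact h3)])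
  by_contra! hlt
  obtain ⟨k, hk, hndvd⟩ := exists_eq_pow_rootMultiplicity_mul_and_not_dvd (f - C q) (hne q) c
  set m := (f - C q).rootMultiplicity c with hm
  apply hndvd
  rw [dvd_iff_isRoot, IsRoot, ← norm_le_zero_iff]
  have h1 : ∀ y, y ≠ c → ‖k.eval y‖ ≤ ‖y - c‖ ^ (N - m) * (‖y‖ + R) ^ (d - N) := by
    intro y hy
    have hpos : 0 < ‖y - c‖ ^ m := pow_pos (norm_pos_iff.mpr (sub_ne_zero.mpr hy)) _
    have h2 := hbound y
    have h3 : f.eval y - q = (y - c) ^ m * k.eval y := by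
      calc f.eval y - q = (f - C q).eval y := by simp
        _ = _ := by rw [hk]; simp
    rw [h3, norm_mul, norm_pow, ← Nat.add_sub_cancel' hlt.le, pow_add, mul_assoc,
      Nat.add_sub_cancel' hlt.le] at h2
    exact le_of_mul_le_mul_left h2 hpos
  have hcont : Continuous fun y : ℂ => ‖y - c‖ ^ (N - m) * (‖y‖ + R) ^ (d - N) := by fun_prop
  have hlim := (hcont.tendsto c).mono_left (nhdsWithin_le_nhds (s := {c}ᶜ))
  rw [sub_self, norm_zero, zero_pow (by omega), zero_mul] at hlim
  exact le_of_tendsto_of_tendsto ((k.continuous.tendsto c).norm.mono_left nhdsWithin_le_nhds) hlim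
    (eventually_mem_nhdsWithin.mono fun y hy => h1 y hy)

theorem le_re_div_sub {z ζ : ℂ} {r : ℝ} (hz : ‖z‖ = r) (hr : 1 < r) (hζ : ‖ζ‖ < 1) :
    r / (r + 1) ≤ (z / (z - ζ)).re := by
  have hne : z - ζ ≠ 0 := by
    intro h
    rw [sub_eq_zero] at h
    rw [h] at hz
    linarith
  have hpos : 0 < Complex.normSq (z - ζ) := Complex.normSq_pos.mpr hne
  have h1 : (z / (z - ζ)).re * Complex.normSq (z - ζ) = (z * (starRingEnd ℂ) (z - ζ)).re := by
    rw [Complex.div_re, Complex.mul_re, Complex.conj_re, Complex.conj_im]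
    field_simp
    ring
  have hzz : z.re * z.re + z.im * z.im = r ^ 2 := by
    rw [← hz, ← Complex.normSq_eq_norm_sq, Complex.normSq_apply]
  have hζζ : ζ.re * ζ.re + ζ.im * ζ.im ≤ 1 := by
    rw [← Complex.normSq_apply, Complex.normSq_eq_norm_sq]
    nlinarith [norm_nonneg ζ]
  have hx : -r ≤ z.re * ζ.re + z.im * ζ.im := by
    have h2 : ‖z * (starRingEnd ℂ) ζ‖ ≤ r := by
      rw [norm_mul, RCLike.norm_conj, hz]
      nlinarith
    have h3 := (abs_le.mp ((Complex.abs_re_le_norm _).trans h2)).1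
    simpa [Complex.mul_re] using h3
  rw [div_le_iff₀ (by linarith), ← mul_le_mul_iff_left₀ hpos]
  have h2 : (z / (z - ζ)).re * (r + 1) * Complex.normSq (z - ζ) =
      (z * (starRingEnd ℂ) (z - ζ)).re * (r + 1) := by
    rw [← h1]; ring
  rw [h2, Complex.normSq_apply, Complex.mul_re]
  simp only [Complex.conj_re, Complex.conj_im, Complex.sub_re, Complex.sub_im]
  nlinarith [mul_nonneg (sub_nonneg.mpr hr.le) (sub_nonneg.mpr hx)]

theorem eval_derivative_prod_X_sub_C {d : ℕ} (ζ : Fin d → ℂ) {z : ℂ} (hz : ∀ j, z ≠ ζ j) :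
    (∏ j, (X - C (ζ j))).derivative.eval z =
      (∏ j, (X - C (ζ j))).eval z * ∑ j, 1 / (z - ζ j) := by
  classical
  rw [derivative_prod_finset, eval_finsetSum, Finset.mul_sum]
  refine Finset.sum_congr rfl fun j _ => ?_
  rw [← Finset.mul_prod_erase _ _ (Finset.mem_univ j)]
  have : z - ζ j ≠ 0 := sub_ne_zero.mpr (hz j)
  simp
  field_simp

/-- Outside the unit disk, `Re (z f' / f)` is large. -/
theorem le_re_mul_derivative_div {d : ℕ} {ζ : Fin d → ℂ} (hζ : ∀ j, ‖ζ j‖ < 1) {z : ℂ} {r : ℝ}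
    (hz : ‖z‖ = r) (hr : 1 < r) :
    d * (r / (r + 1)) ≤ (z * (∏ j, (X - C (ζ j))).derivative.eval z /
      (∏ j, (X - C (ζ j))).eval z).re := by
  have hne : ∀ j, z ≠ ζ j := by
    rintro j rfl
    linarith [hζ j]
  have hfne : (∏ j, (X - C (ζ j))).eval z ≠ 0 := by
    rw [eval_prod, Finset.prod_ne_zero_iff]
    intro j _
    simpa [sub_eq_zero] using hne j
  have h1 : z * (∏ j, (X - C (ζ j))).derivative.eval z / (∏ j, (X - C (ζ j))).eval z =
      ∑ j, z / (z - ζ j) := by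
    rw [eval_derivative_prod_X_sub_C ζ hne, mul_left_comm, mul_div_cancel_left₀ _ hfne,
      Finset.mul_sum]
    simp only [mul_one_div]
  rw [h1, Complex.re_sum]
  calc (d : ℝ) * (r / (r + 1)) = ∑ _j : Fin d, r / (r + 1) := by simp
    _ ≤ _ := Finset.sum_le_sum fun j _ => le_re_div_sub hz hr (hζ j)

theorem hasDerivAt_of_eval_eq {f : ℂ[X]} {γ : ℝ → ℂ} {e : ℂ} {t : ℝ} (hγ : ContinuousAt γ t)
    (hγf : ∀ᶠ s in 𝓝 t, f.eval (γ s) = s * e) (hr : f.derivative.eval (γ t) ≠ 0) :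
    HasDerivAt γ ((f.derivative.eval (γ t))⁻¹ * e) t := by
  obtain ⟨E, hE, hEf⟩ := exists_openPartialHomeomorph_eval hr
  have heq : γ =ᶠ[𝓝 t] fun s : ℝ => E.symm ((s : ℂ) * e) := by
    filter_upwards [hγf, hγ.eventually_mem (E.open_source.mem_nhds hE)] with s h1 h2
    rw [← h1, ← hEf, E.left_inv h2]
  have ht : (t : ℂ) * e = E (γ t) := by rw [hEf, hγf.self_of_nhds]
  have h1 : HasDerivAt E.symm (f.derivative.eval (γ t))⁻¹ ((t : ℂ) * e) := by
    refine E.hasDerivAt_symm ?_ hr ?_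
    · rw [ht]
      exact E.map_source hE
    · rw [ht, E.left_inv hE]
      refine (f.hasDerivAt (γ t)).congr_of_eventuallyEq (Eventually.of_forall hEf)
  have h2 : HasDerivAt (fun s : ℝ => (s : ℂ) * e) e t := by
    simpa using (Complex.ofRealCLM.hasDerivAt (x := t)).mul_const e
  exact (h1.comp t h2).congr_of_eventuallyEq heq

/-- Along a lifted ray the modulus increases strictly outside the unit disk, so that a circle
around the unit disk is met at most once. -/
theorem eq_of_norm_eq_on_ray {d : ℕ} (hd : 0 < d) {ζ : Fin d → ℂ} (hζ : ∀ j, ‖ζ j‖ < 1) {r : ℝ}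
    (hr : 1 < r) {γ : ℝ → ℂ} (hγ : Continuous γ) {e : ℂ} {a b M : ℝ} (ha : 0 < a) (hab : a < b)
    (hbM : b < M) (hγf : ∀ s ∈ Icc 0 M, (∏ j, (X - C (ζ j))).eval (γ s) = s * e)
    (hreg : ∀ s ∈ Icc 0 M, (∏ j, (X - C (ζ j))).derivative.eval (γ s) ≠ 0)
    (h1 : ‖γ a‖ = r) (h2 : ‖γ b‖ = r) : False := by
  set f := ∏ j, (X - C (ζ j)) with hf
  have hder : ∀ s ∈ Icc a b, HasDerivAt (fun s => ‖γ s‖ ^ 2)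
      (2 * inner ℝ (γ s) ((f.derivative.eval (γ s))⁻¹ * e)) s := by
    intro s hs
    refine (hasDerivAt_of_eval_eq hγ.continuousAt ?_
      (hreg s ⟨by linarith [hs.1], by linarith [hs.2]⟩)).norm_sq
    filter_upwards [Ioo_mem_nhds (ha.trans_le hs.1) (hs.2.trans_lt hbM)] with t ht
    exact hγf t ⟨ht.1.le, ht.2.le⟩
  have hpos : ∀ s ∈ Icc a b, ‖γ s‖ = r →
      0 < 2 * inner ℝ (γ s) ((f.derivative.eval (γ s))⁻¹ * e) := by
    intro s hs hsr
    have hs0 : 0 < s := ha.trans_le hs.1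
    have hsM : s ∈ Icc 0 M := ⟨hs0.le, by linarith [hs.2]⟩
    have h3 := le_re_mul_derivative_div hζ hsr hr
    rw [← hf] at h3
    set z := γ s
    have h4 : 0 < (z * f.derivative.eval z / f.eval z).re := by
      refine lt_of_lt_of_le ?_ h3
      have : (0 : ℝ) < d := by exact_mod_cast hd
      have : 0 < r := by linarith
      positivity
    have h5 : 0 < ((z * f.derivative.eval z / f.eval z)⁻¹).re := by
      rw [Complex.inv_re]
      refine div_pos h4 (Complex.normSq_pos.mpr fun h => ?_)
      rw [h] at h4
      simp at h4
    have hz : z ≠ 0 := by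
      intro h
      rw [h, norm_zero] at hsr
      linarith
    have h6 : (starRingEnd ℂ) z * ((f.derivative.eval z)⁻¹ * e) =
        ((‖z‖ ^ 2 / s : ℝ) : ℂ) * (z * f.derivative.eval z / f.eval z)⁻¹ := by
      rw [hγf s hsM]
      have h7 : (s : ℂ) ≠ 0 := by exact_mod_cast hs0.ne'
      have h8 : (starRingEnd ℂ) z * z = ((‖z‖ ^ 2 : ℝ) : ℂ) := by
        rw [mul_comm, Complex.mul_conj, Complex.normSq_eq_norm_sq]
      rw [Complex.ofReal_div, ← h8, inv_div]
      field_simp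
    rw [Complex.inner, mul_comm _ ((starRingEnd ℂ) z), h6, Complex.re_ofReal_mul]
    have : 0 < ‖z‖ ^ 2 / s := by
      rw [hsr]
      have : 0 < r := by linarith
      positivity
    positivity
  have hge : ∀ ⦃s⦄, s ∈ Icc a b → r ^ 2 ≤ ‖γ s‖ ^ 2 := by
    refine image_le_of_deriv_right_lt_deriv_boundary' (f := fun _ => r ^ 2) (f' := fun _ => 0)
      continuousOn_const (fun s _ => hasDerivWithinAt_const _ _ _) (by rw [h1]) (by fun_prop)
      (fun s hs => (hder s ⟨hs.1, hs.2.le⟩).hasDerivWithinAt) fun s hs hsr => ?_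
    refine hpos s ⟨hs.1, hs.2.le⟩ ?_
    exact ((sq_eq_sq₀ (by linarith) (norm_nonneg _)).mp hsr).symm
  have hb := right_mem_Icc.mpr hab.le
  have hslope := (hasDerivAt_iff_tendsto_slope.mp (hder b hb)).eventually_const_lt (hpos b hb h2)
  have hslope' := hslope.filter_mono (nhdsWithin_mono b (s := Iio b) fun x hx => (mem_Iio.mp hx).ne)
  obtain ⟨y, hy, hyab⟩ := (hslope'.and (Ioo_mem_nhdsLT hab)).exists
  have h3 := hge ⟨hyab.1.le, hyab.2.le⟩
  rw [slope_def_field, h2] at hy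
  have := hyab.2
  have h4 := mul_neg_of_pos_of_neg hy (sub_neg.mpr hyab.2)
  rw [div_mul_cancel₀ _ (sub_neg.mpr hyab.2).ne] at h4
  linarith

/-- Influence seen along an entire lifted ray. -/
theorem exists_ray_lift {f : ℂ[X]} (hf : f.Monic) (hd : 0 < f.natDegree) {c z e : ℂ}
    (hinf : Influences f c z) {L M : ℝ} (hL : 0 < L) (hLM : L < M) (hz : f.eval z = L * e)
    (hreg : ∀ (y : ℂ) (t : ℝ), f.eval y = t * e → f.derivative.eval y ≠ 0) :
    ∃ Γ : ℝ → ℂ, Continuous Γ ∧ (∀ t ∈ Icc 0 M, f.eval (Γ t) = t * e) ∧ Γ L = z ∧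
      ∃ t ∈ Icc 0 M, hat f (Γ t) ∈ voronoi (hat f c) := by
  obtain ⟨γ, hγ, hγ1, hγf, s, hs, hv⟩ := influences_iff.mp hinf
  have hM : 0 < M := hL.trans hLM
  have h0 : f.eval (γ 0) = 0 := by simpa using hγf 0 (by simp)
  obtain ⟨δ, hδ, hδ0, hδf⟩ := exists_segment_lift hf hd (z₀ := γ 0) (w := M * e) (by
    intro T hT η hη hη0 hηf
    refine hreg _ (T * M) ?_
    rw [hηf T hT, h0, min_self]
    push_cast
    ring)
  have hΓf : ∀ t ∈ Icc 0 M, f.eval (δ (t / M)) = t * e := by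
    intro t ht
    rw [hδf (t / M) ⟨div_nonneg ht.1 hM.le, (div_le_one hM).mpr ht.2⟩, h0]
    have : (M : ℂ) ≠ 0 := by exact_mod_cast hM.ne'
    push_cast
    field_simp
    ring
  have hagree : EqOn (fun s => δ (s * L / M)) γ (Icc 0 1) := by
    have hmem : ∀ s ∈ Icc (0 : ℝ) 1, s * L ∈ Icc 0 M := fun s hs =>
      ⟨mul_nonneg hs.1 hL.le, by nlinarith [hs.2]⟩
    refine eqOn_of_eval_eqOn (f := f) isPreconnected_Icc (by fun_prop) hγ.continuousOn ?_ ?_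
      (left_mem_Icc.mpr zero_le_one) (by simp [hδ0])
    · intro s hs
      rw [hΓf _ (hmem s hs), hγf s hs, hz]
      push_cast
      ring
    · intro s hs
      exact hreg _ _ (hΓf _ (hmem s hs))
  refine ⟨fun t => δ (t / M), by fun_prop, hΓf, ?_, s * L, ⟨mul_nonneg hs.1 hL.le, ?_⟩, ?_⟩
  · simpa [hγ1] using hagree (right_mem_Icc.mpr zero_le_one)
  · nlinarith [hs.2]
  · have := hagree hs
    beta_reduce at this ⊢
    rwa [this]

/-- In a given direction `e`, a critical point `c` of multiplicity `m` influences at most `m + 1`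
points of the circle of radius `r`. -/
theorem card_influenced_le {d : ℕ} (hd : 0 < d) {ζ : Fin d → ℂ} (hζ : ∀ j, ‖ζ j‖ < 1) {r : ℝ}
    (hr : 1 < r) {f : ℂ[X]} (hf : f = ∏ j, (X - C (ζ j))) {c e : ℂ} (hc : c ∈ criticalPoints f)
    (he : ‖e‖ = 1) (hexc : ∀ c' ∈ criticalPoints f, (f.eval c' * (starRingEnd ℂ) e).im ≠ 0)
    (Z : Finset ℂ) (hZ : ∀ z ∈ Z, ‖z‖ = r ∧ Influences f c z ∧ ∃ L : ℝ, 0 < L ∧ f.eval z = L * e) :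
    Z.card ≤ f.derivative.rootMultiplicity c + 1 := by
  have hfm : f.Monic := hf ▸ monic_finProd_X_sub_C ζ
  have hfd : f.natDegree = d := hf ▸ natDegree_finProd_X_sub_C ζ
  have hd' : 0 < f.natDegree := by omega
  have hee : e * (starRingEnd ℂ) e = 1 := by
    rw [Complex.mul_conj, Complex.normSq_eq_norm_sq, he]
    simp
  have hreg : ∀ (y : ℂ) (t : ℝ), f.eval y = t * e → f.derivative.eval y ≠ 0 := by
    intro y t hy hcrit
    apply hexc y hcrit
    rw [hy, mul_assoc, hee, mul_one, Complex.ofReal_im]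
  set q := f.eval c
  set k := q * (starRingEnd ℂ) e with hk
  have hqk : q = k * e := by
    rw [hk, mul_assoc, mul_comm _ e, hee, mul_one]
  have hkim : k.im ≠ 0 := hexc c hc
  have hnorm : ∀ a b : ℂ, dist (a * e) (b * e) = ‖a - b‖ := by
    intro a b
    rw [dist_eq_norm, ← sub_mul, norm_mul, he, mul_one]
  choose! L hL hLf using fun z hz => (hZ z hz).2.2
  set M := 1 + ∑ z ∈ Z, L z with hM
  have hLM : ∀ z ∈ Z, L z < M := by
    intro z hz
    have := Finset.single_le_sum (f := L) (fun z hz => (hL z hz).le) hz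
    linarith
  choose! Γ hΓ hΓf hΓz t ht hv using fun z hz =>
    exists_ray_lift hfm hd' (hZ z hz).2.1 (hL z hz) (hLM z hz) (hLf z hz) hreg
  choose! ρ hρ g hg hg0 hgf hdist hgc using fun z hz =>
    exists_branch_of_mem_voronoi hfm hd' hc (hv z hz) (hreg _ _ (hΓf z hz _ (ht z hz)))
  have hval : ∀ z ∈ Z, f.eval (Γ z (t z)) = t z * e := fun z hz => hΓf z hz _ (ht z hz)
  have hball : ∀ z ∈ Z, ∀ a : ℂ, a * e ∈ Metric.ball (f.eval (Γ z (t z))) (ρ z) ↔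
      ‖a - t z‖ < ρ z := by
    intro z hz a
    rw [Metric.mem_ball, hval z hz, hnorm]
  have hdist' : ∀ z ∈ Z, ‖k - t z‖ = ρ z := by
    intro z hz
    rw [← hdist z hz, hval z hz, ← hnorm, ← hqk]
  have hre : ∀ z ∈ Z, |k.re - t z| < ρ z := by
    intro z hz
    rw [← hdist' z hz]
    have := Complex.abs_re_lt_norm (z := k - t z)
    simpa [hkim] using this
  have hagree : ∀ z ∈ Z, ∀ z' ∈ Z, ∀ x : ℂ, ‖x - t z‖ < ρ z → ‖x - t z'‖ < ρ z' →
      g z (x * e) = g z' (x * e) → EqOn (Γ z) (Γ z') (Icc 0 M) := by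
    intro z hz z' hz' x hx hx' hgx
    have hbr : ∀ z ∈ Z, ∀ μ ∈ Icc 0 M, |μ - t z| < ρ z → Γ z μ = g z (μ * e) := by
      intro z hz μ hμ hμz
      have hsub : uIcc (t z) μ ⊆ Icc 0 M := uIcc_subset_Icc (ht z hz) hμ
      have hmaps : ∀ s ∈ uIcc (t z) μ,
          ((s : ℂ) * e) ∈ Metric.ball (f.eval (Γ z (t z))) (ρ z) := by
        intro s hs
        rw [hball z hz, ← Complex.ofReal_sub, Complex.norm_real]
        exact (abs_sub_left_of_mem_uIcc hs).trans_lt hμz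
      refine eqOn_of_eval_eqOn (f := f) (isPreconnected_uIcc (a := t z) (b := μ))
        (g' := fun s : ℝ => g z (s * e)) (hΓ z hz).continuousOn
        ((hg z hz).comp (by fun_prop) hmaps) ?_ ?_ left_mem_uIcc ?_ right_mem_uIcc
      · intro s hs
        rw [hΓf z hz s (hsub hs), (hgf z hz _ (hmaps s hs)).1]
      · intro s hs
        exact hreg _ _ (hΓf z hz s (hsub hs))
      · rw [← hval z hz, hg0 z hz]
    have hρz := hρ z hz
    have hρz' := hρ z' hz'
    have hsum : |t z - t z'| < ρ z + ρ z' := by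
      have h1 := hre z hz
      have h2 := hre z' hz'
      rw [abs_lt] at h1 h2 ⊢
      constructor <;> linarith
    set μ := (ρ z' * t z + ρ z * t z') / (ρ z + ρ z') with hμ
    have hμM : μ ∈ Icc 0 M := by
      have h1 := ht z hz
      have h2 := ht z' hz'
      constructor
      · have := h1.1
        have := h2.1
        positivity
      · rw [hμ, div_le_iff₀ (by linarith)]
        nlinarith [h1.2, h2.2]
    have hμ1 : |μ - t z| < ρ z := by
      have : μ - t z = ρ z / (ρ z + ρ z') * (t z' - t z) := by
        rw [hμ]
        field_simp
        ring
      rw [this, abs_mul, abs_of_pos (by positivity), abs_sub_comm, div_mul_eq_mul_div,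
        div_lt_iff₀ (by positivity)]
      exact mul_lt_mul_of_pos_left hsum hρz
    have hμ2 : |μ - t z'| < ρ z' := by
      have : μ - t z' = ρ z' / (ρ z + ρ z') * (t z - t z') := by
        rw [hμ]
        field_simp
        ring
      rw [this, abs_mul, abs_of_pos (by positivity), div_mul_eq_mul_div,
        div_lt_iff₀ (by positivity)]
      exact mul_lt_mul_of_pos_left hsum hρz'
    have hconv : IsPreconnected (Metric.ball (f.eval (Γ z (t z))) (ρ z) ∩
        Metric.ball (f.eval (Γ z' (t z'))) (ρ z')) :=
      ((convex_ball _ _).inter (convex_ball _ _)).isPreconnected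
    have hgg := eqOn_of_eval_eqOn (f := f) hconv ((hg z hz).mono inter_subset_left)
      ((hg z' hz').mono inter_subset_right)
      (fun w hw => by rw [(hgf z hz w hw.1).1, (hgf z' hz' w hw.2).1])
      (fun w hw => (hgf z hz w hw.1).2) ⟨(hball z hz x).mpr hx, (hball z' hz' x).mpr hx'⟩ hgx
    have hμc : ∀ z ∈ Z, |μ - t z| < ρ z →
        ((μ : ℂ) * e) ∈ Metric.ball (f.eval (Γ z (t z))) (ρ z) := by
      intro z hz h
      rwa [hball z hz, ← Complex.ofReal_sub, Complex.norm_real]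
    have hΓμ : Γ z μ = Γ z' μ := by
      rw [hbr z hz μ hμM hμ1, hbr z' hz' μ hμM hμ2]
      exact hgg ⟨hμc z hz hμ1, hμc z' hz' hμ2⟩
    exact eqOn_of_eval_eqOn (f := f) isPreconnected_Icc (hΓ z hz).continuousOn
      (hΓ z' hz').continuousOn (fun s hs => by rw [hΓf z hz s hs, hΓf z' hz' s hs])
      (fun s hs => hreg _ _ (hΓf z hz s hs)) hμM hΓμ
  have hsep : ∀ z ∈ Z, ∀ z' ∈ Z, EqOn (Γ z) (Γ z') (Icc 0 M) → z = z' := by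
    have key : ∀ z ∈ Z, ∀ z' ∈ Z, EqOn (Γ z) (Γ z') (Icc 0 M) → ¬ L z < L z' := by
      intro z hz z' hz' heq hlt
      subst hf
      refine eq_of_norm_eq_on_ray hd hζ hr (hΓ z hz) (hL z hz) hlt (hLM z' hz') (hΓf z hz)
        (fun s hs => hreg _ _ (hΓf z hz s hs)) ?_ ?_
      · rw [hΓz z hz]
        exact (hZ z hz).1
      · rw [heq ⟨(hL z' hz').le, (hLM z' hz').le⟩, hΓz z' hz']
        exact (hZ z' hz').1
    intro z hz z' hz' heq
    have hLL : L z = L z' :=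
      le_antisymm (not_lt.mp (key z' hz' z hz heq.symm)) (not_lt.mp (key z hz z' hz' heq))
    rw [← hΓz z hz, ← hΓz z' hz', ← hLL]
    exact heq ⟨(hL z hz).le, (hLM z hz).le⟩
  let a : ℝ → ℂ := fun ε => k.re + (k.im * (1 - ε) : ℝ) * Complex.I
  have ha : ∀ ε ∈ Ioo (0 : ℝ) 1, ∀ z ∈ Z, ‖a ε - t z‖ < ρ z := by
    intro ε hε z hz
    rw [← hdist' z hz]
    refine lt_of_pow_lt_pow_left₀ 2 (norm_nonneg _) ?_
    rw [← Complex.normSq_eq_norm_sq, ← Complex.normSq_eq_norm_sq, Complex.normSq_apply,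
      Complex.normSq_apply]
    simp [a]
    have h1 : 0 < k.im * k.im := mul_self_pos.mpr hkim
    have h2 : (1 - ε) * (1 - ε) < 1 := by nlinarith [hε.1, hε.2]
    nlinarith
  have hac : Continuous a := by fun_prop
  have ha0 : a 0 = k := by simp [a, Complex.re_add_im]
  have hlim : Tendsto (fun ε => a ε * e) (𝓝[>] 0) (𝓝 q) := by
    have h1 : Continuous fun ε => a ε * e := by fun_prop
    have h2 := (h1.tendsto 0).mono_left (nhdsWithin_le_nhds (s := Ioi 0))
    rwa [ha0, ← hqk] at h2
  have hev : ∀ᶠ ε in 𝓝[>] (0 : ℝ), ε ∈ Ioo (0 : ℝ) 1 := Ioo_mem_nhdsGT one_pos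
  have hmult := card_le_rootMultiplicity_of_tendsto hfm hd' (ι := Z) hlim (c := c)
    (G := fun z ε => g z (a ε * e)) ?_ ?_ ?_
  · rw [Fintype.card_coe] at hmult
    have hroot : (f - C q).IsRoot c := by simp [q]
    have := derivative_rootMultiplicity_of_root hroot
    rw [derivative_sub, derivative_C, sub_zero] at this
    omega
  · rintro ⟨z, hz⟩
    rw [tendsto_iff_norm_sub_tendsto_zero]
    have h1 : Tendsto (fun ε => liftModulus f.natDegree ‖a ε * e - q‖) (𝓝[>] 0) (𝓝 0) := by
      have h2 : Tendsto (fun ε => ‖a ε * e - q‖) (𝓝[>] 0) (𝓝 0) :=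
        tendsto_iff_norm_sub_tendsto_zero.mp hlim
      have h3 := ((continuous_liftModulus f.natDegree).tendsto 0).comp h2
      rwa [liftModulus_zero hd'] at h3
    refine squeeze_zero' (Eventually.of_forall fun _ => norm_nonneg _) ?_ h1
    filter_upwards [hev] with ε hε
    exact hgc z hz _ ((hball z hz _).mpr (ha ε hε z hz))
  · filter_upwards [hev] with ε hε
    rintro ⟨z, hz⟩ ⟨z', hz'⟩ h
    exact Subtype.ext (hsep z hz z' hz' (hagree z hz z' hz' (a ε) (ha ε hε z hz) (ha ε hε z' hz') h))
  · filter_upwards [hev] with ε hε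
    rintro ⟨z, hz⟩
    exact (hgf z hz _ ((hball z hz _).mpr (ha ε hε z hz))).1

open MeasureTheory

/-- The summand of the label sum as a function of the absolute value of the angle. -/
noncomputable def angleCost (x : ℝ) : ℝ :=
  Real.log ((4 + Real.tan x) / ((Real.cos x)⁻¹ - 1))

theorem angleCost_eq {x : ℝ} (h0 : 0 < x) (h1 : x < Real.pi / 2) :
    angleCost x = Real.log (4 * Real.cos x + Real.sin x) + Real.log (1 + Real.cos x) -
      2 * Real.log (Real.sin x) := by
  have hc : 0 < Real.cos x := Real.cos_pos_of_mem_Ioo ⟨by linarith, h1⟩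
  have hs : 0 < Real.sin x := Real.sin_pos_of_pos_of_lt_pi h0 (by linarith [Real.pi_pos])
  have hsc := Real.sin_sq_add_cos_sq x
  have hc1 : Real.cos x < 1 := by nlinarith
  have : (4 + Real.tan x) / ((Real.cos x)⁻¹ - 1) =
      (4 * Real.cos x + Real.sin x) * (1 + Real.cos x) / Real.sin x ^ 2 := by
    have h2 : (Real.cos x)⁻¹ - 1 ≠ 0 := by
      rw [sub_ne_zero]
      intro h
      rw [inv_eq_one] at h
      linarith
    rw [div_eq_div_iff h2 (by positivity), Real.tan_eq_sin_div_cos]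
    field_simp
    have : Real.sin x ^ 2 = (1 - Real.cos x) * (1 + Real.cos x) := by linarith
    rw [this]
    ring
  rw [angleCost, this, Real.log_div (by positivity) (by positivity),
    Real.log_mul (by positivity) (by positivity), Real.log_pow]
  norm_num

theorem angleCost_nonneg {x : ℝ} (h0 : 0 ≤ x) (h1 : x < Real.pi / 2) : 0 ≤ angleCost x := by
  rcases h0.eq_or_lt with rfl | h0
  · simp [angleCost]
  have hc : 0 < Real.cos x := Real.cos_pos_of_mem_Ioo ⟨by linarith, h1⟩
  have hs : 0 < Real.sin x := Real.sin_pos_of_pos_of_lt_pi h0 (by linarith [Real.pi_pos])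
  have hsc := Real.sin_sq_add_cos_sq x
  have hc1 : Real.cos x < 1 := by nlinarith
  refine Real.log_nonneg ?_
  have h2 : 0 < (Real.cos x)⁻¹ - 1 := by
    rw [sub_pos]
    exact (one_lt_inv₀ hc).mpr hc1
  rw [one_le_div h2, Real.tan_eq_sin_div_cos, inv_eq_one_div, sub_le_iff_le_add, div_le_iff₀ hc]
  have : (4 + Real.sin x / Real.cos x + 1) * Real.cos x = 5 * Real.cos x + Real.sin x := by
    field_simp
    ring
  rw [this]
  nlinarith

theorem measurable_angleCost : Measurable angleCost := by
  have ht : Measurable Real.tan := by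
    have : Real.tan = fun x => Real.sin x / Real.cos x := funext Real.tan_eq_sin_div_cos
    rw [this]
    fun_prop
  unfold angleCost
  fun_prop

theorem log_le_log_add_div_sub_one {x a : ℝ} (hx : 0 < x) (ha : 0 < a) :
    Real.log x ≤ Real.log a + (x / a - 1) := by
  have := Real.log_le_sub_one_of_pos (div_pos hx ha)
  rw [Real.log_div hx.ne' ha.ne'] at this
  linarith

theorem intervalIntegrable_angleCost_aux :
    IntervalIntegrable (fun x => Real.log (4 * Real.cos x + Real.sin x) +
      Real.log (1 + Real.cos x)) volume 0 (Real.pi / 2) := by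
  have hpi := Real.pi_pos
  refine ContinuousOn.intervalIntegrable fun x hx => ?_
  rw [uIcc_of_le (by positivity)] at hx
  have hc : 0 ≤ Real.cos x := Real.cos_nonneg_of_mem_Icc ⟨by linarith [hx.1], hx.2⟩
  have hs : 0 ≤ Real.sin x := Real.sin_nonneg_of_nonneg_of_le_pi hx.1 (by linarith [hx.2])
  have hsc := Real.sin_sq_add_cos_sq x
  have h1 : 4 * Real.cos x + Real.sin x ≠ 0 := by
    intro h
    have h2 : Real.cos x = 0 := by linarith
    have h3 : Real.sin x = 0 := by linarith
    rw [h2, h3] at hsc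
    norm_num at hsc
  have h2 : 1 + Real.cos x ≠ 0 := by linarith
  have e1 : Continuous fun x => 4 * Real.cos x + Real.sin x := by fun_prop
  have e2 : Continuous fun x => 1 + Real.cos x := by fun_prop
  exact ((e1.continuousAt.log h1).add (e2.continuousAt.log h2)).continuousWithinAt

theorem integral_angleCost_aux_le :
    ∫ x in (0 : ℝ)..(Real.pi / 2), (Real.log (4 * Real.cos x + Real.sin x) +
      Real.log (1 + Real.cos x)) ≤ (1 / 2) * ((Real.pi / 2) * (3 * Real.log 2 - 1 / 2) + 17 / 16 +
        (Real.pi / 2 + 5 / 2) / Real.exp 1) := by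
  have hpi := Real.pi_pos
  set A : ℝ → ℝ := fun x => Real.log (4 * Real.cos x + Real.sin x) + Real.log (1 + Real.cos x)
    with hA
  have hint : IntervalIntegrable A volume 0 (Real.pi / 2) := intervalIntegrable_angleCost_aux
  have hrefl : ∫ x in (0 : ℝ)..(Real.pi / 2), A (Real.pi / 2 - x) =
      ∫ x in (0 : ℝ)..(Real.pi / 2), A x := by
    rw [intervalIntegral.integral_comp_sub_left]
    simp
  have hint' : IntervalIntegrable (fun x => A (Real.pi / 2 - x)) volume 0 (Real.pi / 2) := by
    have := hint.comp_sub_left (Real.pi / 2)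
    simpa using this.symm
  set B : ℝ → ℝ := fun x => (3 * Real.log 2 - 1 / 2 + 1 / Real.exp 1) +
    (1 / Real.exp 1) * (Real.cos x + Real.sin x) +
    (17 / 8 + 1 / Real.exp 1) * (Real.sin x * Real.cos x) with hB
  have hBint : ∫ x in (0 : ℝ)..(Real.pi / 2), B x =
      (Real.pi / 2) * (3 * Real.log 2 - 1 / 2) + 17 / 16 +
        (Real.pi / 2 + 5 / 2) / Real.exp 1 := by
    rw [hB, intervalIntegral.integral_add (by apply Continuous.intervalIntegrable; fun_prop)
      (by apply Continuous.intervalIntegrable; fun_prop),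
      intervalIntegral.integral_add (by apply Continuous.intervalIntegrable; fun_prop)
      (by apply Continuous.intervalIntegrable; fun_prop),
      intervalIntegral.integral_const_mul, intervalIntegral.integral_const_mul,
      intervalIntegral.integral_add (by apply Continuous.intervalIntegrable; fun_prop)
      (by apply Continuous.intervalIntegrable; fun_prop), integral_sin_mul_cos₁]
    simp
    ring
  have hle : ∀ x ∈ Icc 0 (Real.pi / 2), A x + A (Real.pi / 2 - x) ≤ B x := by
    intro x hx
    have hc : 0 ≤ Real.cos x := Real.cos_nonneg_of_mem_Icc ⟨by linarith [hx.1], hx.2⟩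
    have hs : 0 ≤ Real.sin x := Real.sin_nonneg_of_nonneg_of_le_pi hx.1 (by linarith [hx.2])
    have hsc := Real.sin_sq_add_cos_sq x
    have hpos : 0 < Real.cos x + Real.sin x := by
      by_contra h
      have h2 : Real.cos x = 0 := by linarith
      have h3 : Real.sin x = 0 := by linarith
      rw [h2, h3] at hsc
      norm_num at hsc
    simp only [hA, Real.cos_pi_div_two_sub, Real.sin_pi_div_two_sub]
    have h1 : Real.log (4 * Real.cos x + Real.sin x) + Real.log (4 * Real.sin x + Real.cos x) =
        Real.log (4 + 17 * (Real.sin x * Real.cos x)) := by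
      rw [← Real.log_mul (by linarith) (by linarith)]
      congr 1
      linear_combination 4 * hsc
    have h2 : Real.log (1 + Real.cos x) + Real.log (1 + Real.sin x) =
        Real.log (1 + Real.cos x + Real.sin x + Real.sin x * Real.cos x) := by
      rw [← Real.log_mul (by linarith) (by linarith)]
      congr 1
      ring
    have h3 := log_le_log_add_div_sub_one (x := 4 + 17 * (Real.sin x * Real.cos x)) (a := 2 ^ 3)
      (by positivity) (by norm_num)
    have h4 := log_le_log_add_div_sub_one
      (x := 1 + Real.cos x + Real.sin x + Real.sin x * Real.cos x) (a := Real.exp 1)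
      (by positivity) (Real.exp_pos _)
    rw [Real.log_pow] at h3
    rw [Real.log_exp] at h4
    have h5 : B x = (3 * Real.log 2 + ((4 + 17 * (Real.sin x * Real.cos x)) / 2 ^ 3 - 1)) +
        (1 + ((1 + Real.cos x + Real.sin x + Real.sin x * Real.cos x) / Real.exp 1 - 1)) := by
      rw [hB]
      ring
    push_cast at h3
    linarith
  have h2 : 2 * ∫ x in (0 : ℝ)..(Real.pi / 2), A x ≤ ∫ x in (0 : ℝ)..(Real.pi / 2), B x := by
    calc 2 * ∫ x in (0 : ℝ)..(Real.pi / 2), A x =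
        ∫ x in (0 : ℝ)..(Real.pi / 2), (A x + A (Real.pi / 2 - x)) := by
          rw [intervalIntegral.integral_add hint hint', hrefl]
          ring
      _ ≤ _ := by
          refine intervalIntegral.integral_mono_on (by positivity) (hint.add hint') ?_ hle
          apply Continuous.intervalIntegrable
          fun_prop
  rw [hBint] at h2
  linarith

theorem lintegral_angleCost_le :
    ∫⁻ x in Ioo 0 (Real.pi / 2), ENNReal.ofReal (angleCost x) ≤
      ENNReal.ofReal (3 * Real.pi / 2) := by
  have hpi := Real.pi_pos
  have hls : IntervalIntegrable (fun x => 2 * Real.log (Real.sin x)) volume 0 (Real.pi / 2) :=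
    intervalIntegrable_log_sin.const_mul 2
  have hint := intervalIntegrable_angleCost_aux.sub hls
  have hval := intervalIntegral.integral_sub intervalIntegrable_angleCost_aux hls
  rw [intervalIntegral.integral_const_mul, integral_log_sin_zero_pi_div_two] at hval
  have haux := integral_angleCost_aux_le
  have hle : ∫ x in (0 : ℝ)..(Real.pi / 2), (Real.log (4 * Real.cos x + Real.sin x) +
      Real.log (1 + Real.cos x) - 2 * Real.log (Real.sin x)) ≤ 3 * Real.pi / 2 := by
    have h1 := Real.log_two_lt_d9
    have h2 := Real.pi_gt_d2
    have h3 : 1 / Real.exp 1 ≤ 0.36788 := by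
      rw [div_le_iff₀ (Real.exp_pos _)]
      linarith [Real.exp_one_gt_d9]
    have h4 : (Real.pi / 2 + 5 / 2) / Real.exp 1 ≤ (Real.pi / 2 + 5 / 2) * 0.36788 := by
      rw [div_eq_mul_one_div]
      gcongr
    rw [hval]
    have h5 : Real.pi * Real.log 2 ≤ Real.pi * 0.6931471808 := by gcongr
    nlinarith
  rw [intervalIntegral.integral_of_le (by positivity), integral_Ioc_eq_integral_Ioo] at hle
  rw [intervalIntegrable_iff_integrableOn_Ioo_of_le (by positivity)] at hint
  have heq : ∀ x ∈ Ioo 0 (Real.pi / 2), angleCost x = Real.log (4 * Real.cos x + Real.sin x) +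
      Real.log (1 + Real.cos x) - 2 * Real.log (Real.sin x) := fun x hx => angleCost_eq hx.1 hx.2
  rw [← setIntegral_congr_fun measurableSet_Ioo heq] at hle
  have hint' : IntegrableOn angleCost (Ioo 0 (Real.pi / 2)) :=
    hint.congr_fun (fun x hx => (heq x hx).symm) measurableSet_Ioo
  rw [← ofReal_integral_eq_lintegral_ofReal hint' ?_]
  · exact ENNReal.ofReal_le_ofReal hle
  · filter_upwards [ae_restrict_mem measurableSet_Ioo] with x hx
    exact angleCost_nonneg hx.1.le hx.2

/-- A periodic function integrated over a set that meets almost every orbit at most `N` times. -/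
theorem lintegral_periodic_le {T : ℝ} (hT : 0 < T) (a : ℝ) {G : ℝ → ℝ≥0∞} (hG : Measurable G)
    (hper : Function.Periodic G T) {E : Set ℝ} (hE : MeasurableSet E) (N : ℕ)
    (hN : ∀ᵐ x, ∀ S : Finset ℝ, (∀ y ∈ S, y ∈ E ∧ ∃ n : ℤ, y = x + n * T) → S.card ≤ N) :
    ∫⁻ x in E, G x ≤ N * ∫⁻ x in Ioc a (a + T), G x := by
  classical
  rw [← lintegral_indicator hE, (isAddFundamentalDomain_Ioc hT a volume).lintegral_eq_tsum',
    ← lintegral_tsum, ← lintegral_const_mul _ hG]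
  · refine lintegral_mono_ae ?_
    filter_upwards [ae_restrict_of_ae hN] with x hx
    rw [ENNReal.tsum_eq_iSup_sum]
    refine iSup_le fun S => ?_
    set S' := S.filter fun g : AddSubgroup.zmultiples T => (-g +ᵥ x : ℝ) ∈ E with hS'
    have hz : ∀ g : AddSubgroup.zmultiples T, ∃ n : ℤ, (-g +ᵥ x : ℝ) = x + n * T := by
      rintro ⟨_, n, rfl⟩
      refine ⟨-n, ?_⟩
      change -(n • T) + x = _
      rw [zsmul_eq_mul]
      push_cast
      ring
    have hcard : S'.card ≤ N := by
      have hinj : Function.Injective fun g : AddSubgroup.zmultiples T => (-g +ᵥ x : ℝ) := by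
        intro g g' h
        have h' : -(g : ℝ) + x = -(g' : ℝ) + x := h
        exact Subtype.ext (by linarith)
      rw [← Finset.card_image_of_injective S' hinj]
      refine hx _ fun y hy => ?_
      obtain ⟨g, hg, rfl⟩ := Finset.mem_image.mp hy
      exact ⟨(Finset.mem_filter.mp hg).2, hz g⟩
    calc ∑ g ∈ S, E.indicator G (-g +ᵥ x) = ∑ g ∈ S', G x := by
          rw [hS', Finset.sum_filter]
          refine Finset.sum_congr rfl fun g _ => ?_
          by_cases h : (-g +ᵥ x : ℝ) ∈ E
          · obtain ⟨n, hn⟩ := hz g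
            rw [indicator_of_mem h, if_pos h, hn]
            exact hper.int_mul n x
          · rw [indicator_of_notMem h, if_neg h]
      _ = S'.card * G x := by simp
      _ ≤ N * G x := by gcongr
  · intro g
    exact ((hG.indicator hE).comp (measurable_const_vadd _)).aemeasurable

theorem startPoint_ne_zero {r : ℝ} (hr : 1 < r) (t : ℝ) : startPoint r t ≠ 0 := by
  have : (r : ℂ) ≠ 0 := by exact_mod_cast (by linarith : r ≠ 0)
  exact mul_ne_zero this (Complex.exp_ne_zero _)

theorem norm_startPoint {r : ℝ} (hr : 1 < r) (t : ℝ) : ‖startPoint r t‖ = r := by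
  have : Complex.exp (2 * Real.pi * t * Complex.I) =
      Complex.exp ((2 * Real.pi * t : ℝ) * Complex.I) := by push_cast; rfl
  rw [startPoint, this, norm_mul, Complex.norm_exp_ofReal_mul_I, Complex.norm_real,
    Real.norm_eq_abs, abs_of_pos (by linarith), mul_one]

theorem hasDerivAt_startPoint (r t : ℝ) :
    HasDerivAt (startPoint r) (2 * Real.pi * Complex.I * startPoint r t) t := by
  have h1 : HasDerivAt (fun t : ℝ => 2 * Real.pi * (t : ℂ) * Complex.I)
      (2 * Real.pi * Complex.I) t := by
    have := ((Complex.ofRealCLM.hasDerivAt (x := t)).const_mul (2 * Real.pi : ℂ)).mul_const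
      Complex.I
    simpa using this
  have h2 := (h1.cexp).const_mul (r : ℂ)
  refine h2.congr_deriv ?_
  rw [startPoint]
  ring

theorem injOn_startPoint {r : ℝ} (hr : 1 < r) : InjOn (startPoint r) (Ico 0 1) := by
  intro s hs t ht h
  have hr0 : (r : ℂ) ≠ 0 := by exact_mod_cast (by linarith : r ≠ 0)
  rw [startPoint, startPoint, mul_right_inj' hr0, Complex.exp_eq_exp_iff_exists_int] at h
  obtain ⟨n, hn⟩ := h
  have hpi : (2 * Real.pi * Complex.I : ℂ) ≠ 0 := Complex.two_pi_I_ne_zero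
  have h1 : (s : ℂ) = t + n := by
    apply mul_left_cancel₀ hpi
    linear_combination hn
  have h2 : s = t + n := by exact_mod_cast h1
  have h3 : n = 0 := by
    have h4 : (n : ℝ) < 1 := by linarith [hs.2, ht.1]
    have h5 : (-1 : ℝ) < n := by linarith [hs.1, ht.2]
    have h6 : n < 1 := by exact_mod_cast h4
    have h7 : -1 < n := by exact_mod_cast h5
    omega
  rw [h2, h3]
  simp

/-- The argument of `f` along the circle of radius `r` is a smooth function of fast growth. -/
theorem exists_lifted_argument {d : ℕ} {ζ : Fin d → ℂ} (hζ : ∀ j, ‖ζ j‖ < 1) {r : ℝ}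
    (hr : 1 < r) : ∃ φ φ' : ℝ → ℝ, (∀ t, HasDerivAt φ (φ' t) t) ∧
      (∀ t, 2 * Real.pi * (d * (r / (r + 1))) ≤ φ' t) ∧
      ∀ t, ∃ L : ℝ, 0 < L ∧ (∏ j, (X - C (ζ j))).eval (startPoint r t) =
        L * Complex.exp (φ t * Complex.I) := by
  have hpi := Real.pi_pos
  have hr0 : (r : ℂ) ≠ 0 := by exact_mod_cast (by linarith : r ≠ 0)
  have hz0 := startPoint_ne_zero hr
  have hsub : ∀ j t, startPoint r t - ζ j ≠ 0 := by
    intro j t h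
    rw [sub_eq_zero] at h
    have := norm_startPoint hr t
    rw [h] at this
    linarith [hζ j]
  set ψ : Fin d → ℝ → ℂ := fun j t =>
    2 * Real.pi * t * Complex.I + Complex.log (1 - ζ j / startPoint r t) with hψ
  have hslit : ∀ j t, 1 - ζ j / startPoint r t ∈ Complex.slitPlane := by
    intro j t
    left
    have h1 : ‖ζ j / startPoint r t‖ < 1 := by
      rw [norm_div, norm_startPoint hr, div_lt_one (by linarith)]
      linarith [hζ j]
    have h2 := (Complex.re_le_norm _).trans_lt h1
    rw [Complex.sub_re, Complex.one_re]
    linarith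
  have hψd : ∀ j t, HasDerivAt (ψ j)
      (2 * Real.pi * Complex.I * (startPoint r t / (startPoint r t - ζ j))) t := by
    intro j t
    have h1 : HasDerivAt (fun t : ℝ => 2 * Real.pi * (t : ℂ) * Complex.I)
        (2 * Real.pi * Complex.I) t := by
      have := ((Complex.ofRealCLM.hasDerivAt (x := t)).const_mul (2 * Real.pi : ℂ)).mul_const
        Complex.I
      simpa using this
    have h2 := (((hasDerivAt_startPoint r t).fun_inv (hz0 t)).const_mul (ζ j)).const_sub 1
    have h3 := h1.add (HasDerivAt.clog_real (by simpa only [div_eq_mul_inv] using h2) (hslit j t))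
    refine h3.congr_deriv ?_
    have h4 := hz0 t
    have h5 := hsub j t
    have h6 : 1 - ζ j * (startPoint r t)⁻¹ = (startPoint r t - ζ j) / startPoint r t := by
      field_simp
    rw [h6]
    field_simp
    ring
  have hψe : ∀ j t, startPoint r t - ζ j = r * Complex.exp (ψ j t) := by
    intro j t
    rw [hψ]
    simp only
    rw [Complex.exp_add, Complex.exp_log (Complex.slitPlane_ne_zero (hslit j t)), ← mul_assoc]
    change _ = startPoint r t * _
    have := hz0 t
    field_simp
  refine ⟨fun t => (∑ j, ψ j t).im, fun t => (∑ j, 2 * Real.pi * Complex.I *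
    (startPoint r t / (startPoint r t - ζ j))).im, fun t => ?_, fun t => ?_, fun t => ?_⟩
  · have h1 := HasDerivAt.fun_sum (u := Finset.univ) fun j _ => hψd j t
    exact Complex.imCLM.hasFDerivAt.comp_hasDerivAt t h1
  · have h1 : (∑ j, 2 * Real.pi * Complex.I * (startPoint r t / (startPoint r t - ζ j))).im =
        ∑ j, 2 * Real.pi * (startPoint r t / (startPoint r t - ζ j)).re := by
      rw [Complex.im_sum]
      refine Finset.sum_congr rfl fun j _ => ?_
      rw [mul_assoc, ← Complex.ofReal_ofNat, ← Complex.ofReal_mul, Complex.im_ofReal_mul,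
        Complex.I_mul_im]
    beta_reduce
    rw [h1]
    calc 2 * Real.pi * (d * (r / (r + 1))) = ∑ _j : Fin d, 2 * Real.pi * (r / (r + 1)) := by
          simp
          ring
      _ ≤ _ := by
          refine Finset.sum_le_sum fun j _ => ?_
          have := le_re_div_sub (norm_startPoint hr t) hr (hζ j)
          gcongr
  · have hrpos : 0 < r := by linarith
    refine ⟨r ^ d * Real.exp (∑ j, ψ j t).re, by positivity, ?_⟩
    rw [eval_prod]
    have h1 : ∀ j, (X - C (ζ j)).eval (startPoint r t) = r * Complex.exp (ψ j t) := by
      intro j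
      rw [← hψe]
      simp
    simp only [h1]
    rw [Finset.prod_mul_distrib, ← Complex.exp_sum]
    push_cast
    rw [mul_assoc, ← Complex.exp_add, Complex.re_add_im]
    simp

/-- The summand of the label sum at a critical point with critical value `q`, as a function of the
argument of `f`. -/
noncomputable def angleWeight (q : ℂ) (x : ℝ) : ℝ≥0∞ :=
  ENNReal.ofReal (if |Complex.arg (Complex.exp (x * Complex.I) / q)| < Real.pi / 2 then
    angleCost |Complex.arg (Complex.exp (x * Complex.I) / q)| else 0)

theorem measurable_ite_angleCost : Measurable fun y : ℝ =>
    if |y| < Real.pi / 2 then angleCost |y| else 0 := by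
  refine Measurable.ite ?_ (measurable_angleCost.comp measurable_norm) measurable_const
  exact measurableSet_lt measurable_norm measurable_const

theorem measurable_angleWeight (q : ℂ) : Measurable (angleWeight q) := by
  refine ENNReal.measurable_ofReal.comp (measurable_ite_angleCost.comp ?_)
  refine Complex.measurable_arg.comp (Measurable.div_const ?_ q)
  exact Continuous.measurable (by fun_prop)

theorem angleWeight_periodic (q : ℂ) : Function.Periodic (angleWeight q) (2 * Real.pi) := by
  intro x
  have : Complex.exp ((x + 2 * Real.pi : ℝ) * Complex.I) = Complex.exp (x * Complex.I) := by
    push_cast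
    rw [add_mul, Complex.exp_add, Complex.exp_two_pi_mul_I, mul_one]
  rw [angleWeight, this, angleWeight]

theorem lintegral_angleWeight_le {q : ℂ} (hq : q ≠ 0) :
    ∫⁻ x in Ioc (q.arg - Real.pi) (q.arg - Real.pi + 2 * Real.pi), angleWeight q x ≤
      ENNReal.ofReal (3 * Real.pi) := by
  have hpi := Real.pi_pos
  set k : ℝ → ℝ≥0∞ := fun y =>
    ENNReal.ofReal (if |y| < Real.pi / 2 then angleCost |y| else 0) with hk
  have hkm : Measurable k := ENNReal.measurable_ofReal.comp measurable_ite_angleCost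
  have h1 : ∀ x ∈ Ioc (q.arg - Real.pi) (q.arg - Real.pi + 2 * Real.pi),
      angleWeight q x = k (x - q.arg) := by
    intro x hx
    have h2 : Complex.exp (x * Complex.I) / q =
        ((‖q‖⁻¹ : ℝ) : ℂ) * Complex.exp ((x - q.arg : ℝ) * Complex.I) := by
      conv_lhs => rw [← Complex.norm_mul_exp_arg_mul_I q]
      push_cast
      rw [sub_mul, Complex.exp_sub]
      field_simp
    rw [angleWeight, h2, Complex.arg_real_mul _ (inv_pos.mpr (norm_pos_iff.mpr hq)),
      Complex.arg_exp_mul_I, (toIocMod_eq_self _).mpr]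
    constructor <;> linarith [hx.1, hx.2]
  rw [setLIntegral_congr_fun measurableSet_Ioc h1, ← lintegral_indicator measurableSet_Ioc]
  calc ∫⁻ x, (Ioc (q.arg - Real.pi) (q.arg - Real.pi + 2 * Real.pi)).indicator
        (fun x => k (x - q.arg)) x
      ≤ ∫⁻ x, k (x - q.arg) := lintegral_mono fun x => indicator_le_self _ _ _
    _ = ∫⁻ x, k x := lintegral_sub_right_eq_self k q.arg
    _ = ∫⁻ x in Ioi 0, k x + k (-x) := ?_
    _ ≤ ∫⁻ x in Ioi 0, (Ioo 0 (Real.pi / 2)).indicator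
          (fun x => 2 * ENNReal.ofReal (angleCost x)) x := ?_
    _ ≤ ∫⁻ x in Ioo 0 (Real.pi / 2), 2 * ENNReal.ofReal (angleCost x) := by
        rw [← lintegral_indicator measurableSet_Ioo]
        exact setLIntegral_le_lintegral _ _
    _ = 2 * ∫⁻ x in Ioo 0 (Real.pi / 2), ENNReal.ofReal (angleCost x) :=
        lintegral_const_mul _ (ENNReal.measurable_ofReal.comp measurable_angleCost)
    _ ≤ 2 * ENNReal.ofReal (3 * Real.pi / 2) := by gcongr; exact lintegral_angleCost_le
    _ = ENNReal.ofReal (3 * Real.pi) := by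
        rw [← ENNReal.ofReal_ofNat 2, ← ENNReal.ofReal_mul (by norm_num)]
        congr 1
        ring
  · rw [lintegral_add_left hkm, ← lintegral_add_compl k (measurableSet_Ioi (a := (0 : ℝ)))]
    congr 1
    rw [compl_Ioi, setLIntegral_congr Iio_ae_eq_Iic.symm]
    have := (Measure.measurePreserving_neg (volume : Measure ℝ)).setLIntegral_comp_preimage
      (measurableSet_Iio (a := (0 : ℝ))) hkm
    simpa using this.symm
  · refine setLIntegral_mono' measurableSet_Ioi fun x hx => ?_
    have hx0 : (0 : ℝ) < x := hx
    have h2 : k (-x) = k x := by simp [hk]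
    rw [h2, ← two_mul]
    by_cases h : x < Real.pi / 2
    · rw [indicator_of_mem (show x ∈ Ioo 0 (Real.pi / 2) from ⟨hx0, h⟩)]
      simp [hk, abs_of_pos hx0, h]
    · simp [hk, abs_of_pos hx0, h]

theorem im_mul_conj_exp_eq_zero_countable {q : ℂ} (hq : q ≠ 0) :
    {x : ℝ | (q * (starRingEnd ℂ) (Complex.exp (x * Complex.I))).im = 0}.Countable := by
  refine (countable_range fun n : ℤ => q.arg - n * Real.pi).mono ?_
  intro x hx
  have h1 : q * (starRingEnd ℂ) (Complex.exp (x * Complex.I)) =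
      ‖q‖ * Complex.exp ((q.arg - x : ℝ) * Complex.I) := by
    conv_lhs => rw [← Complex.norm_mul_exp_arg_mul_I q]
    rw [← Complex.exp_conj, mul_assoc, ← Complex.exp_add]
    simp
    left
    ring_nf
  rw [mem_ofPred_eq, h1, Complex.im_ofReal_mul, Complex.exp_ofReal_mul_I_im, mul_eq_zero] at hx
  obtain ⟨n, hn⟩ := Real.sin_eq_zero_iff.mp (hx.resolve_left (norm_ne_zero_iff.mpr hq))
  exact ⟨n, by simp only; linarith⟩

theorem criticalPoints_eq {f : ℂ[X]} (hf : f.derivative ≠ 0) :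
    criticalPoints f = f.derivative.roots.toFinset := by
  ext c
  simp [criticalPoints, hf]

/-- Total weight received by the influence of one critical point. -/
theorem lintegral_influence_le {d : ℕ} (hd : 0 < d) {ζ : Fin d → ℂ} (hζ : ∀ j, ‖ζ j‖ < 1) {r : ℝ}
    (hr : 1 < r) {f : ℂ[X]} (hf : f = ∏ j, (X - C (ζ j))) (hfin : (criticalPoints f).Finite)
    (hne : ∀ c ∈ criticalPoints f, f.eval c ≠ 0) {φ φ' : ℝ → ℝ}
    (hφ : ∀ t, HasDerivAt φ (φ' t) t) (hφ' : ∀ t, 2 * Real.pi * (d * (r / (r + 1))) ≤ φ' t)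
    (hφf : ∀ t, ∃ L : ℝ, 0 < L ∧ f.eval (startPoint r t) = L * Complex.exp (φ t * Complex.I))
    {c : ℂ} (hc : c ∈ criticalPoints f) {A : Set ℝ} (hA : MeasurableSet A)
    (hAI : ∀ t ∈ A, t ∈ Ico (0 : ℝ) 1 ∧ Influences f c (startPoint r t)) :
    ENNReal.ofReal (2 * Real.pi * (d * (r / (r + 1)))) *
      ∫⁻ t in A, angleWeight (f.eval c) (φ t) ≤
    (f.derivative.rootMultiplicity c + 1 : ℕ) * ENNReal.ofReal (3 * Real.pi) := by
  classical
  have hpi := Real.pi_pos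
  have hr0 : 0 < r := by linarith
  have hκ : 0 < 2 * Real.pi * (d * (r / (r + 1))) := by
    have : (0 : ℝ) < d := by exact_mod_cast hd
    positivity
  have hmono : StrictMono φ := strictMono_of_hasDerivAt_pos hφ fun t => hκ.trans_le (hφ' t)
  have hcont : Continuous φ := continuous_iff_continuousAt.mpr fun t => (hφ t).continuousAt
  have hW := measurable_angleWeight (f.eval c)
  have hE : MeasurableSet (φ '' A) :=
    hA.image_of_continuousOn_injOn hcont.continuousOn hmono.injective.injOn
  calc ENNReal.ofReal (2 * Real.pi * (d * (r / (r + 1)))) *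
        ∫⁻ t in A, angleWeight (f.eval c) (φ t)
      = ∫⁻ t in A, ENNReal.ofReal (2 * Real.pi * (d * (r / (r + 1)))) *
          angleWeight (f.eval c) (φ t) :=
        (lintegral_const_mul _ (hW.comp hcont.measurable)).symm
    _ ≤ ∫⁻ t in A, ENNReal.ofReal |φ' t| * angleWeight (f.eval c) (φ t) := by
        refine lintegral_mono fun t => ?_
        gcongr
        exact (hφ' t).trans (le_abs_self _)
    _ = ∫⁻ x in φ '' A, angleWeight (f.eval c) x :=
        (lintegral_image_eq_lintegral_abs_deriv_mul hA (fun t _ => (hφ t).hasDerivWithinAt)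
          hmono.injective.injOn _).symm
    _ ≤ (f.derivative.rootMultiplicity c + 1 : ℕ) *
          ∫⁻ x in Ioc ((f.eval c).arg - Real.pi) ((f.eval c).arg - Real.pi + 2 * Real.pi),
            angleWeight (f.eval c) x := by
        refine lintegral_periodic_le (by positivity) _ hW (angleWeight_periodic _) hE _ ?_
        have hexc : ∀ᵐ x : ℝ, ∀ c' ∈ criticalPoints f,
            (f.eval c' * (starRingEnd ℂ) (Complex.exp (x * Complex.I))).im ≠ 0 := by
          rw [ae_ball_iff hfin.countable]
          intro c' hc'
          exact (im_mul_conj_exp_eq_zero_countable (hne c' hc')).ae_notMem _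
        filter_upwards [hexc] with x hx S hS
        choose! τ hτ using fun y hy => (hS y hy).1
        have hinj : InjOn (fun y => startPoint r (τ y)) S := by
          intro y hy y' hy' h
          have := injOn_startPoint hr (hAI _ (hτ y hy).1).1 (hAI _ (hτ y' hy').1).1 h
          rw [← (hτ y hy).2, ← (hτ y' hy').2, this]
        rw [← Finset.card_image_of_injOn hinj]
        refine card_influenced_le hd hζ hr hf hc (Complex.norm_exp_ofReal_mul_I x) hx _ ?_
        intro z hz
        obtain ⟨y, hy, rfl⟩ := Finset.mem_image.mp hz
        refine ⟨norm_startPoint hr _, (hAI _ (hτ y hy).1).2, ?_⟩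
        obtain ⟨L, hL, hLf⟩ := hφf (τ y)
        refine ⟨L, hL, ?_⟩
        obtain ⟨n, hn⟩ := (hS y hy).2
        rw [hLf, (hτ y hy).2, hn]
        congr 1
        push_cast
        rw [add_mul, Complex.exp_add]
        have : Complex.exp ((n : ℂ) * (2 * Real.pi) * Complex.I) = 1 := by
          rw [mul_assoc]
          exact Complex.exp_int_mul_two_pi_mul_I n
        rw [this, mul_one]
    _ ≤ _ := by
        gcongr
        exact lintegral_angleWeight_le (hne c hc)

theorem measurable_influenceAngle {f : ℂ[X]} (r : ℝ) (c : ℂ) :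
    Measurable fun t => influenceAngle f r t c := by
  refine Complex.measurable_arg.comp (Measurable.div_const ?_ _)
  exact (f.continuous.comp (continuous_startPoint r)).measurable

open Classical in
/-- The contribution of one critical point to the label sum. -/
noncomputable def labelTerm (f : ℂ[X]) (r : ℝ) (c : ℂ) (t : ℝ) : ℝ :=
  if Influences f c (startPoint r t) then
    if |influenceAngle f r t c| < Real.pi / 2 then angleCost |influenceAngle f r t c| else 0
  else 0

theorem labelTerm_nonneg (f : ℂ[X]) (r : ℝ) (c : ℂ) (t : ℝ) : 0 ≤ labelTerm f r c t := by
  unfold labelTerm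
  split_ifs with h1 h2
  · exact angleCost_nonneg (abs_nonneg _) h2
  · exact le_rfl
  · exact le_rfl

theorem labelSum_eq_sum {f : ℂ[X]} (S : Finset ℂ) (hS : criticalPoints f = S) (r t : ℝ) :
    labelSum f r t = ∑ c ∈ S, labelTerm f r c t := by
  classical
  have h1 : {c | c ∈ influencing f r t ∧ |influenceAngle f r t c| < Real.pi / 2} =
      (S.filter fun c => Influences f c (startPoint r t) ∧
        |influenceAngle f r t c| < Real.pi / 2 : Finset ℂ) := by
    ext c
    simp [influencing, hS, and_assoc]
  rw [labelSum, h1, finsum_mem_coe_finset, Finset.sum_filter]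
  refine Finset.sum_congr rfl fun c _ => ?_
  rw [labelTerm, ite_and]
  rfl

theorem aemeasurable_labelTerm {f : ℂ[X]} (hf : f.Monic) (hd : 0 < f.natDegree) (r : ℝ) (c : ℂ) :
    AEMeasurable (labelTerm f r c) (volume.restrict (Ioc 0 1)) := by
  classical
  have hm := (isClosed_setOf_influences hf hd r c).measurableSet
  refine ⟨fun t => if t ∈ {t | t ∈ Icc (0 : ℝ) 1 ∧ Influences f c (startPoint r t)} then
    if |influenceAngle f r t c| < Real.pi / 2 then angleCost |influenceAngle f r t c| else 0
    else 0, ?_, ?_⟩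
  · exact Measurable.ite hm (measurable_ite_angleCost.comp (measurable_influenceAngle r c))
      measurable_const
  · filter_upwards [ae_restrict_mem measurableSet_Ioc] with t ht
    have ht' : t ∈ Icc (0 : ℝ) 1 := Ioc_subset_Icc_self ht
    simp only [labelTerm, ht', true_and]

theorem labelSum_eq_zero_of_forall_eval_ne_zero {f : ℂ[X]} (hf : ∀ z, f.eval z ≠ 0) (r t : ℝ) :
    labelSum f r t = 0 := by
  have h1 : {c | c ∈ influencing f r t ∧ |influenceAngle f r t c| < Real.pi / 2} = ∅ := by
    refine eq_empty_of_forall_notMem fun c hc => ?_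
    obtain ⟨o, ho, -⟩ := hc.1.2
    exact hf (sourcePoint o) (by rw [eval_sourcePoint, ho])
  rw [labelSum, h1, finsum_mem_empty]

theorem sum_rootMultiplicity_derivative_add_one_le (f : ℂ[X]) :
    ∑ c ∈ f.derivative.roots.toFinset, (f.derivative.rootMultiplicity c + 1) ≤
      2 * f.natDegree := by
  classical
  have h1 : f.derivative.roots.card ≤ f.natDegree :=
    (card_roots' _).trans ((natDegree_derivative_le f).trans (Nat.sub_le _ _))
  have h2 : ∑ c ∈ f.derivative.roots.toFinset, f.derivative.rootMultiplicity c =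
      f.derivative.roots.card := by
    simp only [← count_roots]
    exact Multiset.toFinset_sum_count_eq _
  have h3 := Multiset.toFinset_card_le f.derivative.roots
  rw [Finset.sum_add_distrib, h2]
  simp only [Finset.sum_const, smul_eq_mul, mul_one]
  omega

theorem lintegral_labelSum_le {d : ℕ} (hd : 0 < d) {ζ : Fin d → ℂ} (hinj : Function.Injective ζ)
    (hζ : ∀ j, ‖ζ j‖ < 1) {r : ℝ} (hr : 1 < r) {f : ℂ[X]} (hf : f = ∏ j, (X - C (ζ j))) :
    AEMeasurable (labelSum f r) (volume.restrict (Ioc 0 1)) ∧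
      ∫⁻ t in Ioc (0 : ℝ) 1, ENNReal.ofReal (labelSum f r t) ≤
        ENNReal.ofReal (3 * ((r + 1) / r)) := by
  classical
  have hpi := Real.pi_pos
  have hfm : f.Monic := hf ▸ monic_finProd_X_sub_C ζ
  have hfd : f.natDegree = d := hf ▸ natDegree_finProd_X_sub_C ζ
  have hd' : 0 < f.natDegree := by omega
  have hder : f.derivative ≠ 0 := by
    intro h
    have := derivative_eq_zero.mp h
    omega
  set S := f.derivative.roots.toFinset with hS
  have hcrit : criticalPoints f = S := criticalPoints_eq hder
  have hfin : (criticalPoints f).Finite := hcrit ▸ S.finite_toSet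
  have hsep : f.Separable := by
    rw [hf]
    exact separable_prod_X_sub_C_iff.mpr hinj
  have hne : ∀ c ∈ criticalPoints f, f.eval c ≠ 0 := by
    intro c hc h
    obtain ⟨a, b, hab⟩ := hsep
    have h1 := congrArg (eval c) hab
    have h2 : f.derivative.eval c = 0 := hc
    simp [h, h2] at h1
  have hsum : ∀ t, labelSum f r t = ∑ c ∈ S, labelTerm f r c t := labelSum_eq_sum S hcrit r
  have hmeas := fun c => aemeasurable_labelTerm hfm hd' r c
  refine ⟨?_, ?_⟩
  · have : labelSum f r = fun t => ∑ c ∈ S, labelTerm f r c t := funext hsum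
    rw [this]
    exact Finset.aemeasurable_fun_sum S fun c _ => hmeas c
  obtain ⟨φ, φ', hφ, hφ', hφf⟩ := exists_lifted_argument hζ hr
  rw [← hf] at hφf
  set κ := 2 * Real.pi * (d * (r / (r + 1))) with hκ
  have hκ0 : 0 < κ := by
    have : (0 : ℝ) < d := by exact_mod_cast hd
    have : 0 < r := by linarith
    positivity
  have hterm : ∀ c ∈ S, ENNReal.ofReal κ * ∫⁻ t in Ioc (0 : ℝ) 1,
      ENNReal.ofReal (labelTerm f r c t) ≤
        (f.derivative.rootMultiplicity c + 1 : ℕ) * ENNReal.ofReal (3 * Real.pi) := by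
    intro c hc
    have hc' : c ∈ criticalPoints f := by
      rw [hcrit]
      exact hc
    set A : Set ℝ := {t | t ∈ Icc (0 : ℝ) 1 ∧ Influences f c (startPoint r t)} ∩ Ico 0 1 with hA
    have hAm : MeasurableSet A :=
      (isClosed_setOf_influences hfm hd' r c).measurableSet.inter measurableSet_Ico
    have key := lintegral_influence_le hd hζ hr hf hfin hne hφ hφ' hφf hc' hAm
      fun t ht => ⟨ht.2, ht.1.2⟩
    refine le_trans (le_of_eq ?_) key
    congr 1
    rw [setLIntegral_congr Ico_ae_eq_Ioc.symm, ← lintegral_indicator hAm,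
      ← lintegral_indicator measurableSet_Ico]
    refine lintegral_congr fun t => ?_
    by_cases ht : t ∈ Ico (0 : ℝ) 1
    · rw [indicator_of_mem ht]
      by_cases hI : Influences f c (startPoint r t)
      · have htA : t ∈ A := ⟨⟨Ico_subset_Icc_self ht, hI⟩, ht⟩
        obtain ⟨L, hL, hLf⟩ := hφf t
        rw [indicator_of_mem htA, angleWeight, labelTerm, if_pos hI, influenceAngle, hLf,
          mul_div_assoc, Complex.arg_real_mul _ hL]
      · have htA : t ∉ A := fun h => hI h.1.2
        rw [indicator_of_notMem htA, labelTerm, if_neg hI, ENNReal.ofReal_zero]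
    · have htA : t ∉ A := fun h => ht h.2
      rw [indicator_of_notMem ht, indicator_of_notMem htA]
  have hsum' : ∫⁻ t in Ioc (0 : ℝ) 1, ENNReal.ofReal (labelSum f r t) =
      ∑ c ∈ S, ∫⁻ t in Ioc (0 : ℝ) 1, ENNReal.ofReal (labelTerm f r c t) := by
    rw [← lintegral_finsetSum' _ fun c _ => (hmeas c).ennreal_ofReal]
    refine lintegral_congr fun t => ?_
    rw [hsum, ENNReal.ofReal_sum_of_nonneg fun c _ => labelTerm_nonneg f r c t]
  have htotal : ENNReal.ofReal κ * ∫⁻ t in Ioc (0 : ℝ) 1, ENNReal.ofReal (labelSum f r t) ≤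
      ENNReal.ofReal κ * ENNReal.ofReal (3 * ((r + 1) / r)) := by
    calc ENNReal.ofReal κ * ∫⁻ t in Ioc (0 : ℝ) 1, ENNReal.ofReal (labelSum f r t)
        ≤ ∑ c ∈ S, (f.derivative.rootMultiplicity c + 1 : ℕ) * ENNReal.ofReal (3 * Real.pi) := by
          rw [hsum', Finset.mul_sum]
          exact Finset.sum_le_sum hterm
      _ = (∑ c ∈ S, (f.derivative.rootMultiplicity c + 1) : ℕ) * ENNReal.ofReal (3 * Real.pi) := by
          rw [Nat.cast_sum, Finset.sum_mul]
      _ ≤ (2 * d : ℕ) * ENNReal.ofReal (3 * Real.pi) := by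
          gcongr
          rw [← hfd]
          exact sum_rootMultiplicity_derivative_add_one_le f
      _ = ENNReal.ofReal κ * ENNReal.ofReal (3 * ((r + 1) / r)) := by
          rw [← ENNReal.ofReal_natCast, ← ENNReal.ofReal_mul (by positivity),
            ← ENNReal.ofReal_mul hκ0.le]
          congr 1
          have h1 : r ≠ 0 := by linarith
          have h2 : r + 1 ≠ 0 := by linarith
          rw [hκ]
          push_cast
          field_simp
  exact (ENNReal.mul_le_mul_iff_right (ENNReal.ofReal_pos.mpr hκ0).ne' ENNReal.ofReal_ne_top).mp
    htotal

theorem proposition8p2 (d : ℕ) (f : Polynomial ℂ) (hf : f ∈ unitDiskPolys d)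
    (r : ℝ) (hr : 1 < r) :
    IntervalIntegrable (fun t : ℝ => labelSum f r t) MeasureTheory.volume 0 1 ∧
      ∫ t in (0 : ℝ)..1, labelSum f r t ≤ 3 * ((r + 1) / r) := by
  obtain ⟨ζ, hinj, hζ, hprod⟩ := hf
  have hC : 0 ≤ 3 * ((r + 1) / r) := by
    have : 0 < r := by linarith
    positivity
  rcases Nat.eq_zero_or_pos d with rfl | hd
  · have h0 : ∀ t, labelSum f r t = 0 := labelSum_eq_zero_of_forall_eval_ne_zero (by simp [hprod]) r
    simp only [h0]
    exact ⟨intervalIntegrable_const, by simpa using hC⟩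
  obtain ⟨hm, hle⟩ := lintegral_labelSum_le hd hinj hζ hr hprod
  have hder : f.derivative ≠ 0 := by
    intro h
    have h1 := derivative_eq_zero.mp h
    rw [hprod, natDegree_finProd_X_sub_C] at h1
    omega
  have hnn : ∀ t, 0 ≤ labelSum f r t := by
    intro t
    rw [labelSum_eq_sum _ (criticalPoints_eq hder)]
    exact Finset.sum_nonneg fun c _ => labelTerm_nonneg f r c t
  have hint : IntegrableOn (fun t => labelSum f r t) (Ioc 0 1) := by
    refine ⟨hm.aestronglyMeasurable, ?_⟩
    rw [hasFiniteIntegral_iff_ofReal (Eventually.of_forall hnn)]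
    exact hle.trans_lt ENNReal.ofReal_lt_top
  refine ⟨(intervalIntegrable_iff_integrableOn_Ioc_of_le zero_le_one).mpr hint, ?_⟩
  rw [intervalIntegral.integral_of_le zero_le_one,
    integral_eq_lintegral_of_nonneg_ae (Eventually.of_forall hnn) hm.aestronglyMeasurable]
  exact ENNReal.toReal_le_of_le_ofReal hC hle
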